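/- Let $n\in\mathbb N$ and let $C$ be a nonsingular $n\times n$ correlation matrix (symmetric positive definite with unit diagonal). Write $\gamma(C)=\mathrm{vecl}(\log C)\in\mathbb R^{n(n-1)/2}$, where $\mathrm{vecl}$ stacks the entries below the diagonal and, for $C=Q\Lambda Q'$ a spectral decomposition, $\log C=Q(\log\Lambda)Q'$. For $\gamma$ near $\gamma(C)$ there is a unique nonsingular correlation matrix $C(\gamma)$ with $\mathrm{vecl}(\log C(\gamma))=\gamma$, and $C(\gamma(C))=C$. Let $\mathrm{vec}$ stack columns, and let $E_l,E_u,E_d,K_n$ be the matrices with $E_l\mathrm{vec}(B)=\mathrm{vecl}(B)$, $E_u\mathrm{vec}(B)=\mathrm{vecl}(B')$, $E_d\mathrm{vec}(B)=\mathrm{diag}(B)$ and $K_n\mathrm{vec}(B)=\mathrm{vec}(B')$ for all $B\in\mathbb R^{n\times n}$. Put $H_n=I_{n^2}+K_n$ and $C_\otimes=C\otimes C$. (a) Let $\Gamma=\partial\mathrm{vec}(C)/\partial\mathrm{vec}(\log C)'$ be the derivative of $\mathrm{vec}(G)\mapsto\mathrm{vec}(e^G)$, $G\in\mathbb R^{n\times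 n}$, at $G=\log C$; here $e^{\log C}=C$. It exists, and for every orthogonal $Q$ and $\lambda\in\mathbb R^n$ with $\log C=Q\,\mathrm{diag}(\lambda)Q'$, $$\Gamma=(Q\otimes Q)\,\Xi\,(Q\otimes Q)',$$ where $\Xi$ is the $n^2\times n^2$ diagonal matrix whose entry with index $(i-1)n+j$ is $e^{\lambda_i}$ if $\lambda_i=\lambda_j$ and $(e^{\lambda_i}-e^{\lambda_j})/(\lambda_i-\lambda_j)$ otherwise. (b) Let $M=\partial\mathrm{vec}(C(\gamma))/\partial\gamma'$ be taken at $\gamma=\gamma(C)$. It exists, $E_d\Gamma E_d'$ is invertible, and $$M=(E_l+E_u)'E_l\left(I_{n^2}-\Gamma E_d'(E_d\Gamma E_d')^{-1}E_d\right)\Gamma(E_l+E_u)'.$$ (c) Let $\nu>2$ and let $t^{\mathrm{std}}_{n,\nu}(0,C)$ be the distribution on $\mathbb R^n$ with density $$f_C(z)=\frac{\Gamma(\frac{\nu+n}2)}{\Gamma(\frac\nu2)}[(\nu-2)\pi]^{-n/2}|C|^{-1/2}\left[1+\tfrac1{\nu-2}z'C^{-1}z\right]^{-\frac{\nu+n}2}$$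 (with $\Gamma(\cdot)$ here the Gamma function). For every $z\in\mathbb R^n$ the log-likelihood $\gamma\mapsto\log f_{C(\gamma)}(z)$ is differentiable at $\gamma(C)$, and its gradient there, the score, is $$\nabla(z)=\tfrac12M'C_\otimes^{-1}\left[W\,\mathrm{vec}(zz')-\mathrm{vec}(C)\right],\qquad W=\frac{\nu+n}{\nu-2+z'C^{-1}z}.$$ If $Z\sim t^{\mathrm{std}}_{n,\nu}(0,C)$, then $\nabla(Z)\nabla(Z)'$ is integrable and the information matrix $\mathcal I=\mathbb E[\nabla(Z)\nabla(Z)']$ is $$\mathcal I=\tfrac14M'\left[\phi C_\otimes^{-1}H_n+(\phi-1)\mathrm{vec}(C^{-1})\mathrm{vec}(C^{-1})'\right]M,\qquad\phi=\frac{\nu+n}{\nu+n+2}.$$ (d) If instead $f_C$ is the density of $N(0,C)$, so that the log-likelihood is that of the Gaussian model, and $Z\sim N(0,C)$, then the statements in (c) hold with $W$ and $\phi$ replaced by $1$; and $W\to1$ (for each $z$) and $\phi\to1$ as $\nu\to\infty$. -/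

import Mathlib

open Matrix MeasureTheory ProbabilityTheory Filter Topology
open scoped Kronecker

namespace CorrScore

/-! ### Matrix operators

`Matrix.vec` stacks columns: `A.vec (j, i) = A i j`, so coordinates of `ℝ^(n²)` are indexed by pairs
(column, row). -/

/-- Positions strictly below the diagonal, as pairs (column, row) with column `<` row. There are
`n (n - 1) / 2` of them. -/
abbrev LowIdx (n : ℕ) : Type := {p : Fin n × Fin n // p.1 < p.2}

/-- `vecl A`: the vector of the entries of `A` below the diagonal. -/
def vecl {n : ℕ} (A : Matrix (Fin n) (Fin n) ℝ) : LowIdx n → ℝ := fun k => A k.1.2 k.1.1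

/-- The inverse of `vec`. -/
def unvec {n : ℕ} (v : Fin n × Fin n → ℝ) : Matrix (Fin n) (Fin n) ℝ :=
  Matrix.of fun i j => v (j, i)

/-- The elimination matrix with `E_l vec(B) = vecl(B)`. -/
def El (n : ℕ) : Matrix (LowIdx n) (Fin n × Fin n) ℝ :=
  Matrix.of fun k p => if p = k.1 then 1 else 0

/-- The elimination matrix with `E_u vec(B) = vecl(B')`. -/
def Eu (n : ℕ) : Matrix (LowIdx n) (Fin n × Fin n) ℝ :=
  Matrix.of fun k p => if p = k.1.swap then 1 else 0

/-- The elimination matrix with `E_d vec(B) = diag(B)`. -/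
def Ed (n : ℕ) : Matrix (Fin n) (Fin n × Fin n) ℝ :=
  Matrix.of fun i p => if p = (i, i) then 1 else 0

/-- The commutation matrix, with `K_n vec(B) = vec(B')`. -/
def Kn (n : ℕ) : Matrix (Fin n × Fin n) (Fin n × Fin n) ℝ :=
  Matrix.of fun p q => if q = p.swap then 1 else 0

/-- `H_n = I + K_n`. -/
def Hn (n : ℕ) : Matrix (Fin n × Fin n) (Fin n × Fin n) ℝ := 1 + Kn n

theorem unvec_vec {n : ℕ} (B : Matrix (Fin n) (Fin n) ℝ) : unvec B.vec = B := rfl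

theorem El_mulVec_vec {n : ℕ} (B : Matrix (Fin n) (Fin n) ℝ) : El n *ᵥ B.vec = vecl B := by
  ext k; simp [El, Matrix.mulVec, dotProduct, vecl, Matrix.vec]

theorem Eu_mulVec_vec {n : ℕ} (B : Matrix (Fin n) (Fin n) ℝ) : Eu n *ᵥ B.vec = vecl Bᵀ := by
  ext k; simp [Eu, Matrix.mulVec, dotProduct, vecl, Matrix.vec]

theorem Ed_mulVec_vec {n : ℕ} (B : Matrix (Fin n) (Fin n) ℝ) : Ed n *ᵥ B.vec = B.diag := by
  ext k; simp [Ed, Matrix.mulVec, dotProduct, Matrix.vec]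

theorem Kn_mulVec_vec {n : ℕ} (B : Matrix (Fin n) (Fin n) ℝ) : Kn n *ᵥ B.vec = Bᵀ.vec := by
  ext k; simp [Kn, Matrix.mulVec, dotProduct, Matrix.vec]

/-! ### Derivatives -/

/-- The Jacobian matrix `∂f/∂x'` of a map between finite-dimensional coordinate spaces. -/
noncomputable def jacobian {ι κ : Type} [Fintype ι] [DecidableEq ι] [Fintype κ]
    (f : (ι → ℝ) → (κ → ℝ)) (x : ι → ℝ) : Matrix κ ι ℝ :=
  Matrix.of fun k i => fderiv ℝ f x (Pi.single i 1) k

/-- The gradient `∂f/∂x` of a real function of finitely many coordinates. -/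
noncomputable def gradient {ι : Type} [Fintype ι] [DecidableEq ι]
    (f : (ι → ℝ) → ℝ) (x : ι → ℝ) : ι → ℝ :=
  fun i => fderiv ℝ f x (Pi.single i 1)

/-! ### Parametrization of correlation matrices -/

/-- Nonsingular correlation matrices: symmetric positive definite with unit diagonal. -/
def IsCorr {n : ℕ} (C : Matrix (Fin n) (Fin n) ℝ) : Prop :=
  C.PosDef ∧ ∀ i, C i i = 1

/-- The matrix logarithm `Q (log Λ) Q'` of a symmetric positive definite matrix `Q Λ Q'`. -/
noncomputable def logM {n : ℕ} (C : Matrix (Fin n) (Fin n) ℝ) : Matrix (Fin n) (Fin n) ℝ :=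
  cfc Real.log C

/-- `γ(C) = vecl(log C)`. -/
noncomputable def gam {n : ℕ} (C : Matrix (Fin n) (Fin n) ℝ) : LowIdx n → ℝ := vecl (logM C)

open Classical in
/-- `C(γ)`: the nonsingular correlation matrix `C` with `vecl(log C) = γ` (`1` if there is none). -/
noncomputable def corrOf {n : ℕ} (g : LowIdx n → ℝ) : Matrix (Fin n) (Fin n) ℝ :=
  if h : ∃ C, IsCorr C ∧ gam C = g then h.choose else 1

/-- `Γ = ∂vec(C)/∂vec(log C)'`, the derivative of the matrix exponential in all `n²` entries,
at `log C`. -/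
noncomputable def Gam {n : ℕ} (C : Matrix (Fin n) (Fin n) ℝ) :
    Matrix (Fin n × Fin n) (Fin n × Fin n) ℝ :=
  jacobian (fun v => (NormedSpace.exp (unvec v)).vec) (logM C).vec

/-- `M = ∂vec(C)/∂γ'`, the derivative of `γ ↦ vec(C(γ))` at `γ(C)`. -/
noncomputable def MM {n : ℕ} (C : Matrix (Fin n) (Fin n) ℝ) :
    Matrix (Fin n × Fin n) (LowIdx n) ℝ :=
  jacobian (fun g => (corrOf g).vec) (gam C)

/-- Divided difference of `exp`. -/
noncomputable def delta (a b : ℝ) : ℝ :=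
  if a = b then Real.exp a else (Real.exp a - Real.exp b) / (a - b)

/-- The diagonal matrix `Ξ` with entries `δ_{ij}`. -/
noncomputable def Xi {n : ℕ} (l : Fin n → ℝ) : Matrix (Fin n × Fin n) (Fin n × Fin n) ℝ :=
  Matrix.diagonal fun p => delta (l p.1) (l p.2)

/-! ### Distributions and likelihoods -/

/-- The quadratic form `z' C⁻¹ z`. -/
noncomputable def quad {n : ℕ} (C : Matrix (Fin n) (Fin n) ℝ) (z : Fin n → ℝ) : ℝ :=
  z ⬝ᵥ (C⁻¹ *ᵥ z)

/-- Density of the standardized multivariate `t` distribution `t_ν^std(0, C)`, `ν > 2`. -/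
noncomputable def tDensity {n : ℕ} (ν : ℝ) (C : Matrix (Fin n) (Fin n) ℝ) (z : Fin n → ℝ) : ℝ :=
  Real.Gamma ((ν + n) / 2) / Real.Gamma (ν / 2) * ((ν - 2) * Real.pi) ^ (-(n : ℝ) / 2)
    * C.det ^ (-(1 : ℝ) / 2) * (1 + quad C z / (ν - 2)) ^ (-(ν + n) / 2)

/-- Density of the Gaussian distribution `N(0, C)`. -/
noncomputable def gaussDensity {n : ℕ} (C : Matrix (Fin n) (Fin n) ℝ) (z : Fin n → ℝ) : ℝ :=
  (2 * Real.pi) ^ (-(n : ℝ) / 2) * C.det ^ (-(1 : ℝ) / 2) * Real.exp (-(quad C z) / 2)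

/-- The distribution on `ℝⁿ` with density `f` with respect to Lebesgue measure. -/
noncomputable def lawOf {n : ℕ} (f : (Fin n → ℝ) → ℝ) : Measure (Fin n → ℝ) :=
  volume.withDensity fun z => ENNReal.ofReal (f z)

/-- The log-likelihood at the observation `z` of the model with densities `f C`, as a function
of `γ`. -/
noncomputable def logLik {n : ℕ} (f : Matrix (Fin n) (Fin n) ℝ → (Fin n → ℝ) → ℝ)
    (z : Fin n → ℝ) (g : LowIdx n → ℝ) : ℝ :=
  Real.log (f (corrOf g) z)

/-- The score `∇ = ∂ℓ(z)/∂γ` at `γ = γ(C)`. -/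
noncomputable def score {n : ℕ} (f : Matrix (Fin n) (Fin n) ℝ → (Fin n → ℝ) → ℝ)
    (C : Matrix (Fin n) (Fin n) ℝ) (z : Fin n → ℝ) : LowIdx n → ℝ :=
  gradient (logLik f z) (gam C)

/-- The information matrix `𝔼(∇ ∇')` of a random score vector `s`. -/
noncomputable def infoMatrix {Ω : Type*} [MeasurableSpace Ω] (P : Measure Ω) {ι : Type}
    (s : Ω → ι → ℝ) : Matrix ι ι ℝ :=
  Matrix.of fun k l => ∫ ω, s ω k * s ω l ∂P

/-- `W = (ν + n) / (ν - 2 + z' C⁻¹ z)`. -/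
noncomputable def WW {n : ℕ} (ν : ℝ) (C : Matrix (Fin n) (Fin n) ℝ) (z : Fin n → ℝ) : ℝ :=
  (ν + n) / (ν - 2 + quad C z)

/-- `φ = (ν + n) / (ν + n + 2)`. -/
noncomputable def phi (n : ℕ) (ν : ℝ) : ℝ := (ν + n) / (ν + n + 2)

/-- The expression `½ M' C_⊗⁻¹ [w vec(zz') - vec(C)]`. -/
noncomputable def scoreFormula {n : ℕ} (w : ℝ) (C : Matrix (Fin n) (Fin n) ℝ) (z : Fin n → ℝ) :
    LowIdx n → ℝ :=
  (1 / 2 : ℝ) • (((MM C)ᵀ * (C ⊗ₖ C)⁻¹) *ᵥ (w • (vecMulVec z z).vec - C.vec))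

/-- The expression `¼ M' [φ C_⊗⁻¹ H_n + (φ - 1) vec(C⁻¹) vec(C⁻¹)'] M`. -/
noncomputable def infoFormula {n : ℕ} (φ : ℝ) (C : Matrix (Fin n) (Fin n) ℝ) :
    Matrix (LowIdx n) (LowIdx n) ℝ :=
  (1 / 4 : ℝ) • ((MM C)ᵀ *
    (φ • ((C ⊗ₖ C)⁻¹ * Hn n) + (φ - 1) • vecMulVec (C⁻¹).vec (C⁻¹).vec) * MM C)

end CorrScore

/-! The derivative of the matrix exponential is found without a power-series computation. In a
direction commuting with `A` it is multiplication by `exp A`. In a commutator direction it follows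
from the equivariance of `exp` under conjugation. At a diagonal matrix these two kinds of direction
span everything, which produces the divided differences. They are positive, so `Γ` is positive
definite, and so is its compression `E_d Γ E_d'`.

`C(γ)` is `exp` of the symmetric matrix with off-diagonal part `γ` and a diagonal `x` chosen so that
`exp` has unit diagonal. Invertibility of `E_d Γ E_d'` lets the implicit function theorem produce
`x(γ)`. Uniqueness is global: `exp` is strictly monotone for the trace inner product
(`eq_of_trace_exp_sub_mul_sub_eq_zero`), while two solutions have logarithms differing by a diagonal
matrix and exponentials differing by a matrix of zero diagonal. Differentiating the constraint
yields `x'`, hence `M`.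

Both log-likelihoods are a constant minus `½ log det` plus a function `r` of `q = z' C⁻¹ z`. The
score follows by the chain rule, with weight `w = -2 r'(q)`.

For the information matrix put `y = C⁻¹ z`. Both densities are `F(q)` with `F' = -(G/2) F`, where
`G` is the weight, and `G' = -(κ/2) G²`. Integration by parts gives Stein's identity `∫ F G y_i g =
∫ F ∂_i g`. Taking `g = y_j` gives the mean of `G y_i y_j`. Taking `g = G y_j y_k y_l` reproduces
the wanted fourth moment with factor `-κ` plus three known terms, so the moment is `(1 + κ)⁻¹` times
a Gaussian-type sum of pairings. The value `κ = 2/(ν + n)` gives `φ`, and `κ = 0` gives the Gaussian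
case. Neither normalizing constants nor radial distributions are computed. -/

namespace CorrScore

/-! ### Derivative of the matrix exponential and the matrix `Γ` -/

section MatrixExponential

open scoped Matrix.Norms.Operator

variable {n : ℕ}

theorem hasDerivAt_line {E : Type*} [NormedAddCommGroup E] [NormedSpace ℝ E] (a h : E) :
    HasDerivAt (fun t : ℝ => a + t • h) h 0 := by
  have h := HasDerivAt.const_add a ((hasDerivAt_id (0 : ℝ)).smul_const h)
  rw [one_smul] at h
  exact h

theorem hasStrictFDerivAt_matrixExp (A : Matrix (Fin n) (Fin n) ℝ) :
    HasStrictFDerivAt (NormedSpace.exp : Matrix (Fin n) (Fin n) ℝ → Matrix (Fin n) (Fin n) ℝ)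
      (fderiv ℝ NormedSpace.exp A) A :=
  (NormedSpace.exp_analytic (𝕂 := ℝ) A).hasStrictFDerivAt

theorem hasDerivAt_matrixExp_line (A H : Matrix (Fin n) (Fin n) ℝ) :
    HasDerivAt (fun t : ℝ => NormedSpace.exp (A + t • H)) (fderiv ℝ NormedSpace.exp A H) 0 := by
  exact HasFDerivAt.comp_hasDerivAt_of_eq (0 : ℝ) (hasStrictFDerivAt_matrixExp A).hasFDerivAt
    (hasDerivAt_line A H) (by simp)

theorem fderiv_matrixExp_of_commute {A H : Matrix (Fin n) (Fin n) ℝ} (h : Commute A H) :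
    fderiv ℝ NormedSpace.exp A H = NormedSpace.exp A * H := by
  have h1 := hasDerivAt_matrixExp_line A H
  have h2 : HasDerivAt (fun t : ℝ => NormedSpace.exp (A + t • H)) (NormedSpace.exp A * H) 0 := by
    have h3 : (fun t : ℝ => NormedSpace.exp (A + t • H)) =
        fun t : ℝ => NormedSpace.exp A * NormedSpace.exp (t • H) := by
      funext t
      exact Matrix.exp_add_of_commute A (t • H) (h.smul_right t)
    rw [h3]
    have h4 := (hasDerivAt_exp_smul_const (𝕂 := ℝ) H (0 : ℝ)).const_mul (NormedSpace.exp A)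
    rw [zero_smul, NormedSpace.exp_zero, one_mul] at h4
    exact h4
  exact h1.unique h2

/-- `A * K - K * A` is tangent to the conjugation orbit `exp(-tK) A exp(tK)`, and `exp` carries this
orbit to that of `exp A`. Both sides are the velocity of the image curve. -/
theorem fderiv_matrixExp_commutator (A K : Matrix (Fin n) (Fin n) ℝ) :
    fderiv ℝ NormedSpace.exp A (A * K - K * A) =
      NormedSpace.exp A * K - K * NormedSpace.exp A := by
  have key : ∀ B : Matrix (Fin n) (Fin n) ℝ,
      HasDerivAt (fun t : ℝ => NormedSpace.exp (t • -K) * B * NormedSpace.exp (t • K))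
        (B * K - K * B) 0 := by
    intro B
    have h1 := ((hasDerivAt_exp_smul_const (𝕂 := ℝ) (-K) (0 : ℝ)).mul_const B).mul
      (hasDerivAt_exp_smul_const (𝕂 := ℝ) K (0 : ℝ))
    convert! h1 using 1
    simp
    abel
  have h1 : HasDerivAt (fun t : ℝ => NormedSpace.exp
      (NormedSpace.exp (t • -K) * A * NormedSpace.exp (t • K)))
      (fderiv ℝ NormedSpace.exp A (A * K - K * A)) 0 :=
    HasFDerivAt.comp_hasDerivAt_of_eq (0 : ℝ) (hasStrictFDerivAt_matrixExp A).hasFDerivAt (key A)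
      (by simp)
  have h2 : (fun t : ℝ => NormedSpace.exp
      (NormedSpace.exp (t • -K) * A * NormedSpace.exp (t • K))) =
      fun t : ℝ => NormedSpace.exp (t • -K) * NormedSpace.exp A * NormedSpace.exp (t • K) := by
    funext t
    rw [smul_neg, Matrix.exp_neg]
    exact Matrix.exp_conj' _ _ (Matrix.isUnit_exp _)
  rw [h2] at h1
  exact h1.unique (key _)

theorem delta_comm (a b : ℝ) : delta a b = delta b a := by
  by_cases h : a = b
  · rw [h]
  · rw [delta, delta, if_neg h, if_neg (Ne.symm h), ← neg_sub (Real.exp b), ← neg_sub b,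
      neg_div_neg_eq]

theorem delta_pos (a b : ℝ) : 0 < delta a b := by
  unfold delta
  split_ifs with h
  · exact Real.exp_pos a
  · rcases lt_or_gt_of_ne h with h | h
    · exact div_pos_of_neg_of_neg (by simpa using h) (by simpa using h)
    · exact div_pos (by simpa using h) (by simpa using h)

/-- Split `H` into the part on equal eigenvalues, which commutes with `diagonal l`, and the rest,
which is a commutator with `diagonal l`. -/
theorem fderiv_matrixExp_diagonal (l : Fin n → ℝ) (H : Matrix (Fin n) (Fin n) ℝ) :
    fderiv ℝ NormedSpace.exp (diagonal l) H = of fun i j => delta (l i) (l j) * H i j := by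
  set H₁ : Matrix (Fin n) (Fin n) ℝ := of fun i j => if l i = l j then H i j else 0 with hH₁
  -- Where `l i = l j` the division returns `0`; such entries contribute nothing to the commutator
  -- anyway.
  set K : Matrix (Fin n) (Fin n) ℝ := of fun i j => H i j / (l i - l j) with hK
  have hH : H = H₁ + (diagonal l * K - K * diagonal l) := by
    ext i j
    by_cases h : l i = l j
    · simp [hH₁, hK, h]
    · have h' : l i - l j ≠ 0 := sub_ne_zero.2 h
      simp [hH₁, hK, h, diagonal_mul, mul_diagonal]
      field_simp
  have hc : Commute (diagonal l) H₁ := by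
    ext i j
    by_cases h : l i = l j <;> simp [hH₁, diagonal_mul, mul_diagonal, h, mul_comm]
  conv_lhs => rw [hH]
  rw [map_add, fderiv_matrixExp_of_commute hc, fderiv_matrixExp_commutator, Matrix.exp_diagonal]
  ext i j
  by_cases h : l i = l j
  · simp [hH₁, hK, h, delta, diagonal_mul, mul_diagonal, Pi.coe_exp, Real.exp_eq_exp_ℝ]
  · have h' : l i - l j ≠ 0 := sub_ne_zero.2 h
    simp [hH₁, hK, h, delta, diagonal_mul, mul_diagonal, Pi.coe_exp, Real.exp_eq_exp_ℝ]
    field_simp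

theorem isUnit_of_transpose_mul_self {Q : Matrix (Fin n) (Fin n) ℝ} (hQ : Qᵀ * Q = 1) :
    IsUnit Q := by
  rw [isUnit_iff_isUnit_det]; exact isUnit_det_of_left_inverse hQ

theorem fderiv_matrixExp_conj {Q : Matrix (Fin n) (Fin n) ℝ} (hQ : Qᵀ * Q = 1)
    (A H : Matrix (Fin n) (Fin n) ℝ) :
    fderiv ℝ NormedSpace.exp (Q * A * Qᵀ) H =
      Q * fderiv ℝ NormedSpace.exp A (Qᵀ * H * Q) * Qᵀ := by
  have hQ' : Q * Qᵀ = 1 := mul_eq_one_comm.1 hQ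
  have hinv : Q⁻¹ = Qᵀ := inv_eq_left_inv hQ
  have hU := isUnit_of_transpose_mul_self hQ
  have h1 := hasDerivAt_matrixExp_line (Q * A * Qᵀ) H
  have h2 := hasDerivAt_matrixExp_line A (Qᵀ * H * Q)
  have h3 : (fun t : ℝ => NormedSpace.exp (Q * A * Qᵀ + t • H)) =
      fun t : ℝ => Q * NormedSpace.exp (A + t • (Qᵀ * H * Q)) * Qᵀ := by
    funext t
    have := Matrix.exp_conj Q (A + t • (Qᵀ * H * Q)) hU
    rw [hinv] at this
    rw [← this]
    congr 1
    have : Q * (Qᵀ * H * Q) * Qᵀ = H := by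
      calc Q * (Qᵀ * H * Q) * Qᵀ = (Q * Qᵀ) * H * (Q * Qᵀ) := by noncomm_ring
        _ = H := by simp [hQ']
    rw [mul_add, add_mul, mul_smul_comm, smul_mul_assoc, this]
  rw [h3] at h1
  exact h1.unique ((h2.const_mul Q).mul_const Qᵀ)

/-- `vec` as a continuous linear equivalence. -/
noncomputable def vecEquiv (n : ℕ) : Matrix (Fin n) (Fin n) ℝ ≃L[ℝ] (Fin n × Fin n → ℝ) :=
  LinearEquiv.toContinuousLinearEquiv
    { toFun := Matrix.vec
      invFun := unvec
      map_add' := fun _ _ => rfl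
      map_smul' := fun _ _ => rfl
      left_inv := fun _ => rfl
      right_inv := fun _ => rfl }

theorem hasStrictFDerivAt_vecExp (A : Matrix (Fin n) (Fin n) ℝ) :
    HasStrictFDerivAt (fun v : Fin n × Fin n → ℝ => (NormedSpace.exp (unvec v)).vec)
      ((vecEquiv n).toContinuousLinearMap ∘L fderiv ℝ NormedSpace.exp A ∘L
        (vecEquiv n).symm.toContinuousLinearMap) A.vec :=
  (vecEquiv n).hasStrictFDerivAt.comp A.vec
    (HasStrictFDerivAt.comp A.vec (hasStrictFDerivAt_matrixExp A)
      (vecEquiv n).symm.hasStrictFDerivAt)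

theorem jacobian_mulVec {ι κ : Type} [Fintype ι] [DecidableEq ι] [Fintype κ]
    (f : (ι → ℝ) → (κ → ℝ)) (x h : ι → ℝ) : jacobian f x *ᵥ h = fderiv ℝ f x h := by
  ext k
  conv_rhs => rw [pi_eq_sum_univ' h]
  simp [jacobian, mulVec, dotProduct, mul_comm]

theorem Gam_mulVec_vec (C H : Matrix (Fin n) (Fin n) ℝ) :
    Gam C *ᵥ H.vec = (fderiv ℝ NormedSpace.exp (logM C) H).vec := by
  rw [Gam, jacobian_mulVec, (hasStrictFDerivAt_vecExp (logM C)).hasFDerivAt.fderiv]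
  rfl

theorem Gam_eq_of_spectral {C Q : Matrix (Fin n) (Fin n) ℝ} {l : Fin n → ℝ} (hQ : Qᵀ * Q = 1)
    (hC : logM C = Q * diagonal l * Qᵀ) :
    Gam C = (Q ⊗ₖ Q) * Xi l * (Q ⊗ₖ Q)ᵀ := by
  refine Matrix.mulVec_injective (funext fun v => ?_)
  obtain ⟨H, rfl⟩ := Matrix.vec_bijective.2 v
  rw [Gam_mulVec_vec, hC, fderiv_matrixExp_conj hQ, fderiv_matrixExp_diagonal,
    ← mulVec_mulVec, ← mulVec_mulVec, ← kroneckerMap_transpose, kronecker_mulVec_vec,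
    transpose_transpose, ← kronecker_mulVec_vec]
  congr 1
  ext p
  -- Indices of `vec` are (column, row), so the two eigenvalues appear in the opposite order.
  simp [Xi, mulVec_diagonal, vec, delta_comm (l p.1)]

theorem posDef_Gam {C Q : Matrix (Fin n) (Fin n) ℝ} {l : Fin n → ℝ} (hQ : Qᵀ * Q = 1)
    (hC : logM C = Q * diagonal l * Qᵀ) : (Gam C).PosDef := by
  rw [Gam_eq_of_spectral hQ hC]
  have hX : (Xi l).PosDef := PosDef.diagonal fun p => delta_pos _ _
  have hQQ : IsUnit (Q ⊗ₖ Q) := by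
    have : (Q ⊗ₖ Q)ᵀ * (Q ⊗ₖ Q) = 1 := by
      rw [← kroneckerMap_transpose, ← mul_kronecker_mul, hQ, one_kronecker_one]
    rw [isUnit_iff_isUnit_det]; exact isUnit_det_of_left_inverse this
  have := hX.mul_mul_conjTranspose_same (B := Q ⊗ₖ Q) (vecMul_injective_of_isUnit hQQ)
  simpa using this

/-- `E_d'` is injective, so this compression stays positive definite. Its invertibility is what the
implicit function theorem needs. -/
theorem posDef_Ed_Gam_Ed {C : Matrix (Fin n) (Fin n) ℝ} (hC : (Gam C).PosDef) :
    (Ed n * Gam C * (Ed n)ᵀ).PosDef := by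
  have := hC.mul_mul_conjTranspose_same (B := Ed n) ?_
  · simpa using this
  · intro v w h
    ext i
    have := congrFun h (i, i)
    simpa [vecMul, dotProduct, Ed] using this

end MatrixExponential

/-! ### Exponential and logarithm of symmetric matrices -/

variable {n : ℕ}

/-- True for every `C`: outside the self-adjoint matrices `cfc` takes the value `0`. -/
theorem transpose_logM (C : Matrix (Fin n) (Fin n) ℝ) : (logM C)ᵀ = logM C := by
  have h : IsSelfAdjoint (logM C) := cfc_predicate Real.log C
  have h2 := h.star_eq
  rwa [star_eq_conjTranspose, conjTranspose_eq_transpose_of_trivial] at h2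

theorem cfc_eq_spectral {A : Matrix (Fin n) (Fin n) ℝ} (hA : A.IsHermitian) (f : ℝ → ℝ) :
    cfc f A = (hA.eigenvectorUnitary : Matrix (Fin n) (Fin n) ℝ) *
      diagonal (fun i => f (hA.eigenvalues i)) *
      (hA.eigenvectorUnitary : Matrix (Fin n) (Fin n) ℝ)ᵀ := by
  rw [hA.cfc_eq, IsHermitian.cfc, Unitary.conjStarAlgAut_apply, star_eq_conjTranspose,
    conjTranspose_eq_transpose_of_trivial]
  rfl

theorem eigenvectorUnitary_transpose_mul_self {A : Matrix (Fin n) (Fin n) ℝ}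
    (hA : A.IsHermitian) : (hA.eigenvectorUnitary : Matrix (Fin n) (Fin n) ℝ)ᵀ *
      (hA.eigenvectorUnitary : Matrix (Fin n) (Fin n) ℝ) = 1 := by
  have := Unitary.coe_star_mul_self hA.eigenvectorUnitary
  rwa [star_eq_conjTranspose, conjTranspose_eq_transpose_of_trivial] at this

theorem isHermitian_of_transpose_eq {A : Matrix (Fin n) (Fin n) ℝ} (hA : Aᵀ = A) :
    A.IsHermitian := by
  rw [IsHermitian, conjTranspose_eq_transpose_of_trivial, hA]

theorem exists_spectral {A : Matrix (Fin n) (Fin n) ℝ} (hA : Aᵀ = A) :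
    ∃ (Q : Matrix (Fin n) (Fin n) ℝ) (l : Fin n → ℝ), Qᵀ * Q = 1 ∧ A = Q * diagonal l * Qᵀ := by
  have hH := isHermitian_of_transpose_eq hA
  refine ⟨hH.eigenvectorUnitary, hH.eigenvalues, eigenvectorUnitary_transpose_mul_self hH, ?_⟩
  exact (cfc_id ℝ A hH).symm.trans (cfc_eq_spectral hH id)

theorem exp_spectral {Q : Matrix (Fin n) (Fin n) ℝ} (hQ : Qᵀ * Q = 1) (l : Fin n → ℝ) :
    NormedSpace.exp (Q * diagonal l * Qᵀ) = Q * diagonal (fun i => Real.exp (l i)) * Qᵀ := by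
  have hinv : Q⁻¹ = Qᵀ := inv_eq_left_inv hQ
  have hU := isUnit_of_transpose_mul_self hQ
  have := Matrix.exp_conj Q (diagonal l) hU
  rw [hinv, Matrix.exp_diagonal] at this
  rw [this]
  congr 3
  ext i
  rw [Pi.coe_exp, Real.exp_eq_exp_ℝ]

theorem exp_eq_cfc {A : Matrix (Fin n) (Fin n) ℝ} (hA : A.IsHermitian) :
    NormedSpace.exp A = cfc Real.exp A := by
  have h1 : A = cfc id A := (cfc_id ℝ A hA).symm
  rw [cfc_eq_spectral hA] at h1
  rw [cfc_eq_spectral hA]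
  conv_lhs => rw [h1]
  exact exp_spectral (eigenvectorUnitary_transpose_mul_self hA) _

theorem exp_logM {C : Matrix (Fin n) (Fin n) ℝ} (hC : C.PosDef) :
    NormedSpace.exp (logM C) = C := by
  have hH := hC.isHermitian
  rw [logM, cfc_eq_spectral hH, exp_spectral (eigenvectorUnitary_transpose_mul_self hH)]
  have h1 : C = cfc id C := (cfc_id ℝ C hH).symm
  rw [cfc_eq_spectral hH] at h1
  conv_rhs => rw [h1]
  congr 3
  funext i
  exact Real.exp_log (hC.eigenvalues_pos i)

theorem logM_exp {A : Matrix (Fin n) (Fin n) ℝ} (hA : Aᵀ = A) :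
    logM (NormedSpace.exp A) = A := by
  have hH := isHermitian_of_transpose_eq hA
  have hcont : ContinuousOn Real.log (Real.exp '' spectrum ℝ A) := by fun_prop (disch := simp)
  rw [logM, exp_eq_cfc hH, ← cfc_comp' Real.log Real.exp A hcont]
  simp only [Real.log_exp]
  exact cfc_id' ℝ A hH

theorem posDef_exp {A : Matrix (Fin n) (Fin n) ℝ} (hA : Aᵀ = A) :
    (NormedSpace.exp A).PosDef := by
  obtain ⟨Q, l, hQ, hl⟩ := exists_spectral hA
  rw [hl, exp_spectral hQ]
  have hX : (diagonal fun i => Real.exp (l i)).PosDef := PosDef.diagonal fun i => Real.exp_pos _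
  simpa using hX.mul_mul_conjTranspose_same (B := Q)
    (vecMul_injective_of_isUnit (isUnit_of_transpose_mul_self hQ))

/-- Strict monotonicity of the matrix exponential with respect to the trace inner product. -/
theorem eq_of_trace_exp_sub_mul_sub_eq_zero {A B : Matrix (Fin n) (Fin n) ℝ} (hA : Aᵀ = A)
    (hB : Bᵀ = B)
    (h : trace ((NormedSpace.exp A - NormedSpace.exp B) * (A - B)) = 0) : A = B := by
  obtain ⟨U, a, hU, hUA⟩ := exists_spectral hA
  obtain ⟨V, b, hV, hVB⟩ := exists_spectral hB
  have hU' : U * Uᵀ = 1 := mul_eq_one_comm.1 hU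
  have hV' : V * Vᵀ = 1 := mul_eq_one_comm.1 hV
  set R := Uᵀ * V with hR
  -- Read between the eigenbases of `A` and `B`, a difference `f(A) - f(B)` is entrywise `(f(a_i) -
  -- f(b_j)) R_ij`. The trace therefore becomes a sum of the nonnegative terms `(exp a_i - exp
  -- b_j)(a_i - b_j) R_ij²`.
  have key : ∀ f : ℝ → ℝ, ∀ i j,
      (Uᵀ * (U * diagonal (fun i => f (a i)) * Uᵀ - V * diagonal (fun i => f (b i)) * Vᵀ) * V) i j =
        (f (a i) - f (b j)) * R i j := by
    intro f i j
    have h1 : Uᵀ * (U * diagonal (fun i => f (a i)) * Uᵀ - V * diagonal (fun i => f (b i)) * Vᵀ) * V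
        = diagonal (fun i => f (a i)) * R - R * diagonal (fun i => f (b i)) := by
      rw [mul_sub, sub_mul]
      congr 1
      · rw [← mul_assoc, ← mul_assoc, hU, one_mul, mul_assoc]
      · rw [← mul_assoc, ← mul_assoc, mul_assoc _ Vᵀ V, hV, mul_one]
    rw [h1, Matrix.sub_apply, diagonal_mul, mul_diagonal]
    ring
  set X := Uᵀ * (A - B) * V with hX
  set Y := Uᵀ * (NormedSpace.exp A - NormedSpace.exp B) * V with hY
  have hXij : ∀ i j, X i j = (a i - b j) * R i j := by
    intro i j
    rw [hX, hUA, hVB]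
    exact key id i j
  have hYij : ∀ i j, Y i j = (Real.exp (a i) - Real.exp (b j)) * R i j := by
    intro i j
    rw [hY, hUA, hVB, exp_spectral hU, exp_spectral hV]
    exact key Real.exp i j
  have hAB : A - B = U * X * Vᵀ := by
    calc A - B = (U * Uᵀ) * (A - B) * (V * Vᵀ) := by rw [hU', hV', one_mul, mul_one]
      _ = U * X * Vᵀ := by rw [hX]; simp only [mul_assoc]
  have hEt : (NormedSpace.exp A - NormedSpace.exp B)ᵀ = NormedSpace.exp A - NormedSpace.exp B := by
    rw [transpose_sub, ← Matrix.exp_transpose, ← Matrix.exp_transpose, hA, hB]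
  have htr : trace (Yᵀ * X) = 0 := by
    rw [← h, hX, hY, transpose_mul, transpose_mul, hEt, transpose_transpose]
    calc trace (Vᵀ * ((NormedSpace.exp A - NormedSpace.exp B) * U) * (Uᵀ * (A - B) * V))
        = trace (Vᵀ * ((NormedSpace.exp A - NormedSpace.exp B) * (U * Uᵀ) * (A - B) * V)) := by
          simp only [mul_assoc]
      _ = _ := by rw [trace_mul_comm, hU', mul_one, mul_assoc, mul_assoc, hV', mul_one]
  have hsum : ∑ j, ∑ i, Y i j * X i j = 0 := by
    rw [← htr]; simp [trace, mul_apply]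
  have hnn : ∀ i j, 0 ≤ Y i j * X i j := by
    intro i j
    rw [hXij, hYij]
    have : 0 ≤ (Real.exp (a i) - Real.exp (b j)) * (a i - b j) := by
      rcases le_total (a i) (b j) with h | h
      · exact mul_nonneg_of_nonpos_of_nonpos (by simpa using h) (by simpa using h)
      · exact mul_nonneg (by simpa using h) (by simpa using h)
    nlinarith [mul_nonneg this (sq_nonneg (R i j))]
  -- Every term of the sum vanishes, so `a_i = b_j` or `R_ij = 0`; in both cases `X_ij = 0`.
  have hX0 : X = 0 := by
    ext i j
    have h1 := (Finset.sum_eq_zero_iff_of_nonneg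
      (fun j _ => Finset.sum_nonneg fun i _ => hnn i j)).1 hsum j (Finset.mem_univ j)
    have h2 := (Finset.sum_eq_zero_iff_of_nonneg (fun i _ => hnn i j)).1 h1 i (Finset.mem_univ i)
    rw [hXij]
    rw [hXij, hYij] at h2
    by_cases hab : a i = b j
    · simp [hab]
    · have : Real.exp (a i) - Real.exp (b j) ≠ 0 := by
        rw [sub_ne_zero]; simpa using hab
      rcases mul_eq_zero.1 h2 with h3 | h3
      · rw [(mul_eq_zero.1 h3).resolve_left this]; simp
      · exact h3
  rw [← sub_eq_zero, hAB, hX0]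
  simp

/-! ### Symmetric matrices assembled from off-diagonal entries and a diagonal -/

theorem El_add_Eu_transpose_mulVec (g : LowIdx n → ℝ) (j i : Fin n) :
    ((El n + Eu n)ᵀ *ᵥ g) (j, i) =
      if h : j < i then g ⟨(j, i), h⟩ else if h : i < j then g ⟨(i, j), h⟩ else 0 := by
  have h1 : ((El n + Eu n)ᵀ *ᵥ g) (j, i) =
      ∑ k : LowIdx n, ((if (j, i) = k.1 then g k else 0) + if (j, i) = k.1.swap then g k else 0) := by
    simp [mulVec, dotProduct, El, Eu, add_mul]
  rw [h1, Finset.sum_add_distrib]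
  rcases lt_trichotomy j i with h | h | h
  · rw [dif_pos h, Finset.sum_eq_single (⟨(j, i), h⟩ : LowIdx n), Finset.sum_eq_zero]
    · simp
    · rintro ⟨⟨k1, k2⟩, hk⟩ -
      rw [if_neg]
      rintro h2
      simp at h2 hk
      omega
    · rintro ⟨⟨k1, k2⟩, hk⟩ - hne
      rw [if_neg]
      rintro h2
      apply hne
      simp at h2 ⊢
      simp [h2]
    · simp
  · subst h
    simp only [lt_irrefl, dite_false]
    rw [Finset.sum_eq_zero, Finset.sum_eq_zero, add_zero]
    all_goals
      rintro ⟨⟨k1, k2⟩, hk⟩ -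
      rw [if_neg]
      rintro h2
      simp at h2 hk
      omega
  · rw [dif_neg (not_lt.2 h.le), dif_pos h, Finset.sum_eq_zero,
      Finset.sum_eq_single (⟨(i, j), h⟩ : LowIdx n)]
    · simp
    · rintro ⟨⟨k1, k2⟩, hk⟩ - hne
      rw [if_neg]
      rintro h2
      apply hne
      simp at h2 ⊢
      simp [h2]
    · simp
    · rintro ⟨⟨k1, k2⟩, hk⟩ -
      rw [if_neg]
      rintro h2
      simp at h2 hk
      omega

theorem Ed_transpose_mulVec (x : Fin n → ℝ) (j i : Fin n) :
    ((Ed n)ᵀ *ᵥ x) (j, i) = if j = i then x i else 0 := by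
  by_cases h : j = i
  · subst h
    simp [mulVec, dotProduct, Ed]
  · rw [if_neg h]
    simp only [mulVec, dotProduct, Ed, transpose_apply, of_apply, Prod.mk.injEq, ite_mul, one_mul,
      zero_mul]
    refine Finset.sum_eq_zero fun k _ => if_neg ?_
    rintro ⟨rfl, rfl⟩
    exact h rfl

/-- The vectorized symmetric matrix with prescribed off-diagonal entries and diagonal. -/
noncomputable def symVec (g : LowIdx n → ℝ) (x : Fin n → ℝ) : Fin n × Fin n → ℝ :=
  (El n + Eu n)ᵀ *ᵥ g + (Ed n)ᵀ *ᵥ x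

theorem symVec_apply (g : LowIdx n → ℝ) (x : Fin n → ℝ) (j i : Fin n) :
    symVec g x (j, i) =
      if h : j < i then g ⟨(j, i), h⟩ else if h : i < j then g ⟨(i, j), h⟩ else x i := by
  rw [symVec, Pi.add_apply, El_add_Eu_transpose_mulVec, Ed_transpose_mulVec]
  rcases lt_trichotomy j i with h | h | h
  · simp [h, h.ne]
  · subst h; simp
  · simp [h, h.ne', not_lt.2 h.le]

theorem symVec_vecl_diag {A : Matrix (Fin n) (Fin n) ℝ} (hA : Aᵀ = A) :
    symVec (vecl A) A.diag = A.vec := by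
  ext ⟨j, i⟩
  rw [symVec_apply]
  have hs : A j i = A i j := congrFun (congrFun hA i) j
  rcases lt_trichotomy j i with h | h | h
  · simp [h, vecl, vec]
  · subst h; simp [vec]
  · simp [h, not_lt.2 h.le, vecl, vec, hs]

theorem transpose_unvec_symVec (g : LowIdx n → ℝ) (x : Fin n → ℝ) :
    (unvec (symVec g x))ᵀ = unvec (symVec g x) := by
  ext i j
  simp only [transpose_apply, unvec, of_apply, symVec_apply]
  rcases lt_trichotomy j i with h | h | h
  · simp [h, not_lt.2 h.le]
  · subst h; simp
  · simp [h, not_lt.2 h.le]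

theorem vecl_unvec_symVec (g : LowIdx n → ℝ) (x : Fin n → ℝ) :
    vecl (unvec (symVec g x)) = g := by
  ext ⟨⟨j, i⟩, h⟩
  simp only [vecl, unvec, of_apply, symVec_apply]
  simp at h
  simp [h]

/-! ### The correlation matrix `C(γ)`: uniqueness, existence, derivative -/

theorem isCorr_one : IsCorr (1 : Matrix (Fin n) (Fin n) ℝ) := ⟨PosDef.one, by simp⟩

theorem IsCorr.transpose_eq {C : Matrix (Fin n) (Fin n) ℝ} (hC : IsCorr C) : Cᵀ = C := by
  have := hC.1.isHermitian
  rwa [IsHermitian, conjTranspose_eq_transpose_of_trivial] at this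

/-- The logarithms differ by a diagonal matrix, whereas `C - D` has zero diagonal. Their trace
pairing is zero, and strict monotonicity of `exp` applies. -/
theorem IsCorr.eq_of_gam_eq {C D : Matrix (Fin n) (Fin n) ℝ} (hC : IsCorr C) (hD : IsCorr D)
    (h : gam C = gam D) : C = D := by
  have hlog : logM C = logM D := by
    refine eq_of_trace_exp_sub_mul_sub_eq_zero (transpose_logM C) (transpose_logM D) ?_
    have hdiag : logM C - logM D = diagonal ((logM C).diag - (logM D).diag) := by
      have h1 : (logM C).vec - (logM D).vec =
          (diagonal ((logM C).diag - (logM D).diag)).vec := by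
        rw [← symVec_vecl_diag (transpose_logM C), ← symVec_vecl_diag (transpose_logM D)]
        change symVec (gam C) _ - symVec (gam D) _ = _
        rw [h, symVec, symVec, add_sub_add_left_eq_sub, ← mulVec_sub]
        ext ⟨j, i⟩
        rw [Ed_transpose_mulVec]
        by_cases hij : j = i
        · subst hij; simp [vec]
        · simp [vec, hij, diagonal_apply_ne' _ hij]
      exact vec_inj.1 (by rw [vec_sub, h1])
    rw [exp_logM hC.1, exp_logM hD.1, hdiag]
    simp [trace, mul_diagonal, hC.2, hD.2]
  rw [← exp_logM hC.1, ← exp_logM hD.1, hlog]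

theorem corrOf_spec {g : LowIdx n → ℝ} (h : ∃ C, IsCorr C ∧ gam C = g) :
    IsCorr (corrOf g) ∧ gam (corrOf g) = g := by
  unfold corrOf
  rw [dif_pos h]
  exact h.choose_spec

theorem corrOf_gam {C : Matrix (Fin n) (Fin n) ℝ} (hC : IsCorr C) : corrOf (gam C) = C := by
  have h := corrOf_spec ⟨C, hC, rfl⟩
  exact h.1.eq_of_gam_eq hC h.2

/-- The default value `1` is itself a correlation matrix. Identities for correlation matrices thus
hold along `corrOf` for all `g` and can be differentiated directly. -/
theorem isCorr_corrOf (g : LowIdx n → ℝ) : IsCorr (corrOf g) := by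
  by_cases h : ∃ C, IsCorr C ∧ gam C = g
  · exact (corrOf_spec h).1
  · unfold corrOf
    rw [dif_neg h]
    exact isCorr_one

/-- Multiplication of vectors by a matrix as a continuous linear map. -/
noncomputable def mulVecL {ι κ : Type} [Fintype ι] [Fintype κ] (A : Matrix κ ι ℝ) :
    (ι → ℝ) →L[ℝ] (κ → ℝ) :=
  LinearMap.toContinuousLinearMap A.mulVecLin

theorem mulVecL_apply {ι κ : Type} [Fintype ι] [Fintype κ] (A : Matrix κ ι ℝ) (v : ι → ℝ) :
    mulVecL A v = A *ᵥ v := rfl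

/-- The entrywise form of the matrix exponential. -/
noncomputable def expVec (v : Fin n × Fin n → ℝ) : Fin n × Fin n → ℝ :=
  (NormedSpace.exp (unvec v)).vec

theorem hasStrictFDerivAt_expVec (C : Matrix (Fin n) (Fin n) ℝ) :
    HasStrictFDerivAt expVec (mulVecL (Gam C)) (logM C).vec := by
  have h := hasStrictFDerivAt_vecExp (logM C)
  convert! h using 1
  ext1 v
  obtain ⟨H, rfl⟩ := Matrix.vec_bijective.2 v
  rw [mulVecL_apply, Gam_mulVec_vec]
  rfl

theorem hasStrictFDerivAt_symVec (p : (LowIdx n → ℝ) × (Fin n → ℝ)) :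
    HasStrictFDerivAt (fun p : (LowIdx n → ℝ) × (Fin n → ℝ) => symVec p.1 p.2)
      ((mulVecL (El n + Eu n)ᵀ).coprod (mulVecL (Ed n)ᵀ)) p :=
  ((mulVecL (El n + Eu n)ᵀ).coprod (mulVecL (Ed n)ᵀ)).hasStrictFDerivAt

theorem posDef_Gam_of_isCorr (C : Matrix (Fin n) (Fin n) ℝ) : (Gam C).PosDef := by
  obtain ⟨Q, l, hQ, hl⟩ := exists_spectral (transpose_logM C)
  exact posDef_Gam hQ hl

/-- Implicit function theorem for the equation `diag (exp G) = 1`, the unknown being the diagonal of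
`G`. The partial derivative in that unknown is `E_d Γ E_d'`. -/
theorem exists_implicit_diag {C : Matrix (Fin n) (Fin n) ℝ} (hC : IsCorr C) :
    ∃ (x : (LowIdx n → ℝ) → Fin n → ℝ) (x' : (LowIdx n → ℝ) →L[ℝ] (Fin n → ℝ)),
      HasFDerivAt x x' (gam C) ∧ x (gam C) = (logM C).diag ∧
      ∀ᶠ g in 𝓝 (gam C), Ed n *ᵥ expVec (symVec g (x g)) = 1 := by
  set u : (LowIdx n → ℝ) × (Fin n → ℝ) := (gam C, (logM C).diag) with hu
  have hsu : symVec u.1 u.2 = (logM C).vec := symVec_vecl_diag (transpose_logM C)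
  have hd : HasStrictFDerivAt (fun p : (LowIdx n → ℝ) × (Fin n → ℝ) =>
      Ed n *ᵥ expVec (symVec p.1 p.2))
      (mulVecL (Ed n) ∘L mulVecL (Gam C) ∘L
        (mulVecL (El n + Eu n)ᵀ).coprod (mulVecL (Ed n)ᵀ)) u := by
    have h1 : HasStrictFDerivAt expVec (mulVecL (Gam C)) (symVec u.1 u.2) := by
      rw [hsu]; exact hasStrictFDerivAt_expVec C
    exact (mulVecL (Ed n)).hasStrictFDerivAt.comp u
      (HasStrictFDerivAt.comp u h1 (hasStrictFDerivAt_symVec u))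
  have hdet := (posDef_Ed_Gam_Ed (posDef_Gam_of_isCorr C)).det_pos.ne'.isUnit
  have hinv : ((mulVecL (Ed n) ∘L mulVecL (Gam C) ∘L
        (mulVecL (El n + Eu n)ᵀ).coprod (mulVecL (Ed n)ᵀ)) ∘L
        ContinuousLinearMap.inr ℝ (LowIdx n → ℝ) (Fin n → ℝ)).IsInvertible := by
    refine ContinuousLinearMap.IsInvertible.of_inverse
      (g := mulVecL (Ed n * Gam C * (Ed n)ᵀ)⁻¹) ?_ ?_
    · ext1 v
      simp only [ContinuousLinearMap.comp_apply, ContinuousLinearMap.inr_apply,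
        ContinuousLinearMap.coprod_apply, map_zero, zero_add, mulVecL_apply, mulVec_mulVec,
        ContinuousLinearMap.id_apply]
      rw [← Matrix.mul_assoc, ← Matrix.mul_assoc, mul_nonsing_inv _ hdet, one_mulVec]
    · ext1 v
      simp only [ContinuousLinearMap.comp_apply, ContinuousLinearMap.inr_apply,
        ContinuousLinearMap.coprod_apply, map_zero, zero_add, mulVecL_apply, mulVec_mulVec,
        ContinuousLinearMap.id_apply]
      rw [← Matrix.mul_assoc (Ed n), nonsing_inv_mul _ hdet, one_mulVec]
  refine ⟨hd.implicitFunctionOfProdDomain hinv, _,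
    (hd.hasStrictFDerivAt_implicitFunctionOfProdDomain hinv).hasFDerivAt, ?_, ?_⟩
  · exact (hd.eventually_apply_eq_iff_implicitFunctionOfProdDomain hinv).self_of_nhds.mp rfl
  · filter_upwards [hd.eventually_apply_implicitFunctionOfProdDomain hinv] with g hg
    rw [hg]
    rw [hsu, expVec, unvec_vec, exp_logM hC.1, Ed_mulVec_vec]
    ext i
    exact hC.2 i

theorem isCorr_exp_symVec {g : LowIdx n → ℝ} {x : Fin n → ℝ}
    (h : Ed n *ᵥ expVec (symVec g x) = 1) :
    IsCorr (NormedSpace.exp (unvec (symVec g x))) ∧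
      gam (NormedSpace.exp (unvec (symVec g x))) = g := by
  refine ⟨⟨posDef_exp (transpose_unvec_symVec g x), fun i => ?_⟩, ?_⟩
  · rw [expVec, Ed_mulVec_vec] at h
    exact congrFun h i
  · rw [gam, logM_exp (transpose_unvec_symVec g x), vecl_unvec_symVec]

theorem eventually_existsUnique_isCorr {C : Matrix (Fin n) (Fin n) ℝ} (hC : IsCorr C) :
    ∀ᶠ g in 𝓝 (gam C), ∃! C' : Matrix (Fin n) (Fin n) ℝ, IsCorr C' ∧ gam C' = g := by
  obtain ⟨x, x', -, -, hx⟩ := exists_implicit_diag hC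
  filter_upwards [hx] with g hg
  have h := isCorr_exp_symVec hg
  exact ⟨_, h, fun D hD => hD.1.eq_of_gam_eq h.1 (hD.2.trans h.2.symm)⟩

/-- On symmetric matrices `(E_l + E_u)' E_l` only removes the diagonal, here a constant. Once
differentiated, this shows that the factor fixes the derivative of `C(γ)`. -/
theorem El_add_Eu_mul_El_mulVec_corr {C : Matrix (Fin n) (Fin n) ℝ} (hC : IsCorr C) :
    ((El n + Eu n)ᵀ * El n) *ᵥ C.vec = C.vec - (Ed n)ᵀ *ᵥ 1 := by
  have h := symVec_vecl_diag hC.transpose_eq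
  have h1 : C.diag = 1 := funext hC.2
  rw [h1, symVec] at h
  rw [← mulVec_mulVec, El_mulVec_vec, ← h, add_sub_cancel_right]

theorem hasFDerivAt_corrOf {C : Matrix (Fin n) (Fin n) ℝ} (hC : IsCorr C) :
    HasFDerivAt (fun g => (corrOf g).vec)
      (mulVecL ((El n + Eu n)ᵀ * El n * (1 - Gam C * (Ed n)ᵀ *
        (Ed n * Gam C * (Ed n)ᵀ)⁻¹ * Ed n) * Gam C * (El n + Eu n)ᵀ)) (gam C) := by
  obtain ⟨x, x', hx', hx0, hx⟩ := exists_implicit_diag hC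
  have hdet := (posDef_Ed_Gam_Ed (posDef_Gam_of_isCorr C)).det_pos.ne'.isUnit
  have hsym : symVec (gam C) (x (gam C)) = (logM C).vec := by
    rw [hx0]; exact symVec_vecl_diag (transpose_logM C)
  have hev : (fun g => (corrOf g).vec) =ᶠ[𝓝 (gam C)] fun g => expVec (symVec g (x g)) := by
    filter_upwards [hx] with g hg
    have h := isCorr_exp_symVec hg
    have h2 := corrOf_spec ⟨_, h⟩
    rw [expVec, h2.1.eq_of_gam_eq h.1 (h2.2.trans h.2.symm)]
  set L : (LowIdx n → ℝ) →L[ℝ] (Fin n × Fin n → ℝ) := mulVecL (Gam C) ∘L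
    (mulVecL (El n + Eu n)ᵀ).coprod (mulVecL (Ed n)ᵀ) ∘L
      (ContinuousLinearMap.id ℝ _).prod x' with hL
  have hder : HasFDerivAt (fun g => (corrOf g).vec) L (gam C) := by
    refine HasFDerivAt.congr_of_eventuallyEq ?_ hev
    have h1 : HasFDerivAt expVec (mulVecL (Gam C)) (symVec (gam C) (x (gam C))) := by
      rw [hsym]; exact (hasStrictFDerivAt_expVec C).hasFDerivAt
    have h2 : HasFDerivAt (fun g => (g, x g)) ((ContinuousLinearMap.id ℝ _).prod x') (gam C) :=
      (hasFDerivAt_id _).prodMk hx'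
    exact HasFDerivAt.comp (gam C) h1
      (HasFDerivAt.comp (gam C) (hasStrictFDerivAt_symVec _).hasFDerivAt h2)
  convert hder using 1
  -- The diagonal of `corrOf g` is constant. This linear equation determines `x'`, so the formula
  -- for the derivative of the implicit function is not needed.
  have hEd : mulVecL (Ed n) ∘L L = 0 := by
    have h1 := (mulVecL (Ed n)).hasFDerivAt.comp (gam C) hder
    have h2 : (mulVecL (Ed n) ∘ fun g => (corrOf g).vec) = fun _ => (1 : Fin n → ℝ) := by
      funext g
      simp only [Function.comp_apply, mulVecL_apply, Ed_mulVec_vec]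
      exact funext (isCorr_corrOf g).2
    rw [h2] at h1
    exact h1.unique (hasFDerivAt_const _ _)
  have hEl : mulVecL ((El n + Eu n)ᵀ * El n) ∘L L = L := by
    have h1 := (mulVecL ((El n + Eu n)ᵀ * El n)).hasFDerivAt.comp (gam C) hder
    have h2 : (mulVecL ((El n + Eu n)ᵀ * El n) ∘ fun g => (corrOf g).vec) =
        fun g => (corrOf g).vec - (Ed n)ᵀ *ᵥ 1 := by
      funext g
      simp only [Function.comp_apply, mulVecL_apply]
      exact El_add_Eu_mul_El_mulVec_corr (isCorr_corrOf g)
    rw [h2] at h1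
    exact h1.unique (hder.sub_const _)
  ext1 h
  have hLh : L h = Gam C *ᵥ ((El n + Eu n)ᵀ *ᵥ h + (Ed n)ᵀ *ᵥ x' h) := rfl
  have hx'h : (Ed n * Gam C * (Ed n)ᵀ) *ᵥ x' h = -(Ed n * Gam C * (El n + Eu n)ᵀ) *ᵥ h := by
    have h1 : Ed n *ᵥ L h = 0 := congrArg (fun T => T h) hEd
    rw [hLh, mulVec_add, mulVec_add, mulVec_mulVec, mulVec_mulVec, mulVec_mulVec,
      mulVec_mulVec] at h1
    rw [neg_mulVec]
    exact eq_neg_of_add_eq_zero_right h1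
  have hx'h2 : x' h = -((Ed n * Gam C * (Ed n)ᵀ)⁻¹ * Ed n * Gam C * (El n + Eu n)ᵀ) *ᵥ h := by
    have h1 := congrArg (fun v => (Ed n * Gam C * (Ed n)ᵀ)⁻¹ *ᵥ v) hx'h
    simp only [mulVec_mulVec] at h1
    rw [nonsing_inv_mul _ hdet, one_mulVec] at h1
    rw [h1, Matrix.mul_neg]
    simp only [Matrix.mul_assoc]
  have h3 : L h = ((1 - Gam C * (Ed n)ᵀ * (Ed n * Gam C * (Ed n)ᵀ)⁻¹ * Ed n) * Gam C *
      (El n + Eu n)ᵀ) *ᵥ h := by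
    rw [hLh, hx'h2, mulVec_mulVec, ← add_mulVec, mulVec_mulVec]
    congr 1
    rw [Matrix.sub_mul, Matrix.sub_mul, Matrix.mul_add, Matrix.mul_neg, Matrix.mul_neg, Matrix.one_mul, ← sub_eq_add_neg]
    simp only [Matrix.mul_assoc]
  have h4 : ((El n + Eu n)ᵀ * El n) *ᵥ L h = L h := congrArg (fun T => T h) hEl
  rw [← h4, h3, mulVec_mulVec, mulVecL_apply]
  simp only [Matrix.mul_assoc]

theorem MM_mulVec {C : Matrix (Fin n) (Fin n) ℝ} (h : LowIdx n → ℝ) :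
    MM C *ᵥ h = fderiv ℝ (fun g => (corrOf g).vec) (gam C) h := jacobian_mulVec _ _ _

theorem MM_eq {C : Matrix (Fin n) (Fin n) ℝ} (hC : IsCorr C) :
    MM C = (El n + Eu n)ᵀ * El n * (1 - Gam C * (Ed n)ᵀ *
        (Ed n * Gam C * (Ed n)ᵀ)⁻¹ * Ed n) * Gam C * (El n + Eu n)ᵀ := by
  refine Matrix.mulVec_injective (funext fun v => ?_)
  rw [MM_mulVec, (hasFDerivAt_corrOf hC).fderiv]
  rfl

/-! ### Derivatives of the determinant and the quadratic form; the score -/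

theorem differentiable_det_unvec :
    Differentiable ℝ fun v : Fin n × Fin n → ℝ => (unvec v).det := by
  simp only [det_apply, unvec, of_apply]
  fun_prop

theorem hasDerivAt_det_one_add_smul (A : Matrix (Fin n) (Fin n) ℝ) :
    HasDerivAt (fun t : ℝ => (1 + t • A).det) (trace A) 0 := by
  have h : (fun t : ℝ => (1 + t • A).det) = fun t => 1 + trace A * t +
      (det (1 + (Polynomial.X : Polynomial ℝ) • A.map Polynomial.C)).divX.divX.eval t * t ^ 2 := by
    funext t
    exact det_one_add_smul t A
  rw [h]
  have h1 := ((hasDerivAt_id (0 : ℝ)).const_mul (trace A)).const_add 1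
  have h2 := ((det (1 + (Polynomial.X : Polynomial ℝ) • A.map Polynomial.C)).divX.divX.hasDerivAt
    (0 : ℝ)).mul ((hasDerivAt_id (0 : ℝ)).pow 2)
  convert! h1.add h2 using 1
  simp

/-- Jacobi's formula, from `det (C + tH) = det C * det (1 + t C⁻¹ H)`. -/
theorem hasFDerivAt_det_unvec {C : Matrix (Fin n) (Fin n) ℝ} (hC : IsUnit C.det) :
    ∃ L : (Fin n × Fin n → ℝ) →L[ℝ] ℝ,
      HasFDerivAt (fun v : Fin n × Fin n → ℝ => (unvec v).det) L C.vec ∧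
      ∀ H : Matrix (Fin n) (Fin n) ℝ, L H.vec = C.det * trace (C⁻¹ * H) := by
  refine ⟨_, (differentiable_det_unvec C.vec).hasFDerivAt, fun H => ?_⟩
  have h1 : HasDerivAt (fun t : ℝ => (unvec (C.vec + t • H.vec)).det)
      (fderiv ℝ (fun v : Fin n × Fin n → ℝ => (unvec v).det) C.vec H.vec) 0 :=
    HasFDerivAt.comp_hasDerivAt_of_eq (0 : ℝ) (differentiable_det_unvec C.vec).hasFDerivAt
      (hasDerivAt_line C.vec H.vec) (by simp)
  have h2 : (fun t : ℝ => (unvec (C.vec + t • H.vec)).det) =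
      fun t : ℝ => C.det * (1 + t • (C⁻¹ * H)).det := by
    funext t
    rw [← det_mul, mul_add, mul_one, mul_smul_comm, mul_nonsing_inv_cancel_left _ _ hC]
    rfl
  rw [h2] at h1
  exact h1.unique ((hasDerivAt_det_one_add_smul _).const_mul _)

section

open scoped Matrix.Norms.Operator

theorem hasFDerivAt_quad_unvec {C : Matrix (Fin n) (Fin n) ℝ} (hC : IsUnit C.det)
    (z : Fin n → ℝ) :
    ∃ L : (Fin n × Fin n → ℝ) →L[ℝ] ℝ,
      HasFDerivAt (fun v : Fin n × Fin n → ℝ => quad (unvec v) z) L C.vec ∧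
      ∀ H : Matrix (Fin n) (Fin n) ℝ, L H.vec = -(z ⬝ᵥ ((C⁻¹ * H * C⁻¹) *ᵥ z)) := by
  obtain ⟨u, rfl⟩ := (isUnit_iff_isUnit_det C).2 hC
  let ev : Matrix (Fin n) (Fin n) ℝ →L[ℝ] ℝ := LinearMap.toContinuousLinearMap
    { toFun := fun A => z ⬝ᵥ (A *ᵥ z)
      map_add' := fun A B => by rw [add_mulVec, dotProduct_add]
      map_smul' := fun r A => by rw [smul_mulVec, dotProduct_smul]; rfl }
  have h1 : HasFDerivAt (Ring.inverse : Matrix (Fin n) (Fin n) ℝ → Matrix (Fin n) (Fin n) ℝ)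
      (-ContinuousLinearMap.mulLeftRight ℝ _ ↑u⁻¹ ↑u⁻¹)
      ((vecEquiv n).symm (u : Matrix (Fin n) (Fin n) ℝ).vec) := hasFDerivAt_ringInverse u
  have h3 := HasFDerivAt.comp (u : Matrix (Fin n) (Fin n) ℝ).vec h1
      (vecEquiv n).symm.hasFDerivAt
  have h2 : HasFDerivAt (fun v : Fin n × Fin n → ℝ => ev (Ring.inverse (unvec v)))
      (ev ∘L (-ContinuousLinearMap.mulLeftRight ℝ _ ↑u⁻¹ ↑u⁻¹) ∘L
        (vecEquiv n).symm.toContinuousLinearMap) (u : Matrix (Fin n) (Fin n) ℝ).vec :=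
    HasFDerivAt.comp (u : Matrix (Fin n) (Fin n) ℝ).vec ev.hasFDerivAt h3
  refine ⟨ev ∘L (-ContinuousLinearMap.mulLeftRight ℝ _ ↑u⁻¹ ↑u⁻¹) ∘L
        (vecEquiv n).symm.toContinuousLinearMap, ?_, ?_⟩
  · convert! h2 using 1
    funext v
    rw [← nonsing_inv_eq_ringInverse]
    rfl
  · intro H
    have h3 : ((u⁻¹ : (Matrix (Fin n) (Fin n) ℝ)ˣ) : Matrix (Fin n) (Fin n) ℝ) =
        (↑u : Matrix (Fin n) (Fin n) ℝ)⁻¹ := coe_units_inv u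
    change z ⬝ᵥ ((-(((u⁻¹ : (Matrix (Fin n) (Fin n) ℝ)ˣ) : Matrix (Fin n) (Fin n) ℝ) * H *
      ((u⁻¹ : (Matrix (Fin n) (Fin n) ℝ)ˣ) : Matrix (Fin n) (Fin n) ℝ))) *ᵥ z) = _
    rw [h3, neg_mulVec, dotProduct_neg]

end

theorem transpose_inv_of_posDef {C : Matrix (Fin n) (Fin n) ℝ} (hC : C.PosDef) :
    (C⁻¹)ᵀ = C⁻¹ := by
  have := hC.inv.isHermitian
  rwa [IsHermitian, conjTranspose_eq_transpose_of_trivial] at this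

theorem quad_nonneg {C : Matrix (Fin n) (Fin n) ℝ} (hC : C.PosDef) (z : Fin n → ℝ) :
    0 ≤ quad C z := by
  simpa [quad] using hC.inv.posSemidef.dotProduct_mulVec_nonneg z

/-- `(C ⊗ C)⁻¹ = C⁻¹ ⊗ C⁻¹` turns `vec (zz')` into `vec (yy')` with `y = C⁻¹ z` and `vec C` into
`vec C⁻¹`. Stein's identity applies to these coordinates. -/
theorem scoreFormula_apply {C : Matrix (Fin n) (Fin n) ℝ} (hC : C.PosDef) (w : ℝ)
    (z : Fin n → ℝ) (k : LowIdx n) :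
    scoreFormula w C z k = 1 / 2 * ∑ p : Fin n × Fin n,
      MM C p k * (w * ((C⁻¹ *ᵥ z) p.1 * (C⁻¹ *ᵥ z) p.2) - C⁻¹ p.1 p.2) := by
  have hs := transpose_inv_of_posDef hC
  have hu : IsUnit C.det := hC.det_pos.ne'.isUnit
  have h1 : (C ⊗ₖ C)⁻¹ *ᵥ (w • (vecMulVec z z).vec - C.vec) =
      (w • vecMulVec (C⁻¹ *ᵥ z) (C⁻¹ *ᵥ z) - C⁻¹).vec := by
    rw [inv_kronecker, ← vec_smul, ← vec_sub, kronecker_mulVec_vec, hs]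
    congr 1
    rw [mul_sub, sub_mul, nonsing_inv_mul _ hu, one_mul, mul_smul_comm, smul_mul_assoc,
      mul_vecMulVec, vecMulVec_mul, ← mulVec_transpose, hs]
  rw [scoreFormula, ← mulVec_mulVec, h1]
  simp only [Pi.smul_apply, smul_eq_mul, mulVec, dotProduct, transpose_apply]
  congr 1
  refine Finset.sum_congr rfl fun p _ => ?_
  have h2 : C⁻¹ p.2 p.1 = C⁻¹ p.1 p.2 := congrFun (congrFun hs p.1) p.2
  simp only [vec, Matrix.sub_apply, Matrix.smul_apply, vecMulVec_apply, h2, smul_eq_mul, mulVec,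
    dotProduct]
  ring

theorem hasFDerivAt_corrOf_MM {C : Matrix (Fin n) (Fin n) ℝ} (hC : IsCorr C) :
    HasFDerivAt (fun g => (corrOf g).vec) (mulVecL (MM C)) (gam C) := by
  rw [MM_eq hC]; exact hasFDerivAt_corrOf hC

/-- Shared by both models, which differ only in the radial function `r`; the weight is `w = -2 r'`.
-/
theorem score_of_log_density {C : Matrix (Fin n) (Fin n) ℝ} (hC : IsCorr C)
    {f : Matrix (Fin n) (Fin n) ℝ → (Fin n → ℝ) → ℝ} {z : Fin n → ℝ} {c w : ℝ} {r : ℝ → ℝ}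
    (hf : ∀ D : Matrix (Fin n) (Fin n) ℝ, D.PosDef →
      Real.log (f D z) = c - 1 / 2 * Real.log D.det + r (quad D z))
    (hr : HasDerivAt r (-(w / 2)) (quad C z)) :
    DifferentiableAt ℝ (logLik f z) (gam C) ∧ score f C z = scoreFormula w C z := by
  have hu : IsUnit C.det := hC.1.det_pos.ne'.isUnit
  have hs := transpose_inv_of_posDef hC.1
  have hC0 : corrOf (gam C) = C := corrOf_gam hC
  have hcorr := hasFDerivAt_corrOf_MM hC
  obtain ⟨Ld, hLd, hLdH⟩ := hasFDerivAt_det_unvec hu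
  have hdet : HasFDerivAt (fun g => (corrOf g).det) (Ld ∘L mulVecL (MM C)) (gam C) := by
    rw [← hC0] at hLd
    simpa only [Function.comp_def, unvec_vec] using HasFDerivAt.comp (gam C) hLd hcorr
  obtain ⟨Lq, hLq, hLqH⟩ := hasFDerivAt_quad_unvec hu z
  have hquad : HasFDerivAt (fun g => quad (corrOf g) z) (Lq ∘L mulVecL (MM C)) (gam C) := by
    rw [← hC0] at hLq
    simpa only [Function.comp_def, unvec_vec] using HasFDerivAt.comp (gam C) hLq hcorr
  have hlog : HasFDerivAt (logLik f z)
      (-((1 / 2 : ℝ) • (C.det⁻¹ • (Ld ∘L mulVecL (MM C)))) + (-(w / 2)) • (Lq ∘L mulVecL (MM C))) (gam C) := by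
    have h1 : logLik f z = fun g => (c - 1 / 2 * Real.log (corrOf g).det) + r (quad (corrOf g) z) :=
      funext fun g => hf _ (isCorr_corrOf g).1
    rw [h1]
    have hd := hdet.log (by rw [hC0]; exact hu.ne_zero)
    rw [hC0] at hd
    refine ((hd.const_mul (1 / 2)).const_sub c).add ?_
    refine HasDerivAt.comp_hasFDerivAt (gam C) ?_ hquad
    rw [hC0]
    exact hr
  refine ⟨hlog.differentiableAt, ?_⟩
  ext k
  rw [scoreFormula_apply hC.1, score, gradient, hlog.fderiv]
  set H : Matrix (Fin n) (Fin n) ℝ := unvec ((MM C).col k) with hH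
  have hHv : mulVecL (MM C) (Pi.single k 1) = H.vec := by
    rw [mulVecL_apply, mulVec_single_one]; rfl
  simp only [_root_.add_apply, _root_.neg_apply,
    _root_.smul_apply, ContinuousLinearMap.comp_apply, hHv, hLqH,
    hLdH, smul_eq_mul]
  rw [inv_mul_cancel_left₀ hu.ne_zero]
  have h1 : trace (C⁻¹ * H) = ∑ p : Fin n × Fin n, MM C p k * C⁻¹ p.1 p.2 := by
    rw [Fintype.sum_prod_type]
    simp only [trace, diag_apply, mul_apply]
    refine Finset.sum_congr rfl fun i _ => Finset.sum_congr rfl fun j _ => ?_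
    rw [mul_comm]
    rfl
  have h2 : z ⬝ᵥ ((C⁻¹ * H * C⁻¹) *ᵥ z) =
      ∑ p : Fin n × Fin n, MM C p k * ((C⁻¹ *ᵥ z) p.1 * (C⁻¹ *ᵥ z) p.2) := by
    rw [← mulVec_mulVec, ← mulVec_mulVec, dotProduct_mulVec, ← mulVec_transpose, hs,
      Fintype.sum_prod_type, Finset.sum_comm]
    generalize C⁻¹ *ᵥ z = y
    simp only [dotProduct]
    refine Finset.sum_congr rfl fun i _ => ?_
    rw [mulVec, dotProduct, Finset.mul_sum]
    refine Finset.sum_congr rfl fun j _ => ?_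
    change _ * (MM C (j, i) k * _) = _
    ring
  rw [h1, h2]
  simp only [mul_sub, Finset.sum_sub_distrib]
  rw [show ∑ p : Fin n × Fin n, MM C p k * (w * ((C⁻¹ *ᵥ z) p.1 * (C⁻¹ *ᵥ z) p.2)) =
    w * ∑ p : Fin n × Fin n, MM C p k * ((C⁻¹ *ᵥ z) p.1 * (C⁻¹ *ᵥ z) p.2) by
      rw [Finset.mul_sum]; exact Finset.sum_congr rfl fun p _ => by ring]
  ring

theorem score_gaussDensity {C : Matrix (Fin n) (Fin n) ℝ} (hC : IsCorr C) (z : Fin n → ℝ) :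
    DifferentiableAt ℝ (logLik gaussDensity z) (gam C) ∧
      score gaussDensity C z = scoreFormula 1 C z := by
  refine score_of_log_density hC (c := Real.log ((2 * Real.pi) ^ (-(n : ℝ) / 2)))
    (r := fun q => -q / 2) (fun D hD => ?_) ?_
  · have h1 : (2 * Real.pi) ^ (-(n : ℝ) / 2) ≠ 0 := by positivity
    have h2 : D.det ^ (-(1 : ℝ) / 2) ≠ 0 := (Real.rpow_pos_of_pos hD.det_pos _).ne'
    rw [gaussDensity, Real.log_mul (mul_ne_zero h1 h2) (Real.exp_pos _).ne', Real.log_mul h1 h2,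
      Real.log_exp, Real.log_rpow hD.det_pos]
    ring
  · have := (hasDerivAt_id (quad C z)).neg.div_const 2
    convert! this using 1
    ring

theorem score_tDensity {C : Matrix (Fin n) (Fin n) ℝ} (hC : IsCorr C) {ν : ℝ} (hν : 2 < ν)
    (z : Fin n → ℝ) :
    DifferentiableAt ℝ (logLik (tDensity ν) z) (gam C) ∧
      score (tDensity ν) C z = scoreFormula (WW ν C z) C z := by
  have hν' : 0 < ν - 2 := by linarith
  refine score_of_log_density hC
    (c := Real.log (Real.Gamma ((ν + n) / 2) / Real.Gamma (ν / 2) *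
      ((ν - 2) * Real.pi) ^ (-(n : ℝ) / 2)))
    (r := fun q => -(ν + n) / 2 * Real.log (1 + q / (ν - 2))) (fun D hD => ?_) ?_
  · have hG1 := Real.Gamma_pos_of_pos (show 0 < (ν + n) / 2 by positivity)
    have hG2 := Real.Gamma_pos_of_pos (show 0 < ν / 2 by positivity)
    have h1 : Real.Gamma ((ν + n) / 2) / Real.Gamma (ν / 2) *
      ((ν - 2) * Real.pi) ^ (-(n : ℝ) / 2) ≠ 0 := by positivity
    have h2 : D.det ^ (-(1 : ℝ) / 2) ≠ 0 := (Real.rpow_pos_of_pos hD.det_pos _).ne'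
    have hq : 0 < 1 + quad D z / (ν - 2) := by
      have := quad_nonneg hD z
      positivity
    rw [tDensity, Real.log_mul (mul_ne_zero h1 h2) (Real.rpow_pos_of_pos hq _).ne',
      Real.log_mul h1 h2, Real.log_rpow hD.det_pos, Real.log_rpow hq]
    ring
  · have h0 := quad_nonneg hC.1 z
    have hq : 0 < 1 + quad C z / (ν - 2) := by positivity
    have := (((((hasDerivAt_id (quad C z)).div_const (ν - 2)).const_add 1).log hq.ne').const_mul
      (-(ν + n) / 2))
    convert! this using 1
    have h3 : 0 < ν - 2 + quad C z := by positivity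
    simp only [WW, id]
    field_simp

/-! ### Bounds and directional derivatives for the quadratic form -/

theorem quad_add_smul {C : Matrix (Fin n) (Fin n) ℝ} (hC : C.PosDef) (z v : Fin n → ℝ) (t : ℝ) :
    quad C (z + t • v) = quad C z + t * (2 * (v ⬝ᵥ (C⁻¹ *ᵥ z))) + t ^ 2 * quad C v := by
  have hs : z ⬝ᵥ (C⁻¹ *ᵥ v) = v ⬝ᵥ (C⁻¹ *ᵥ z) := by
    rw [dotProduct_mulVec, ← mulVec_transpose, transpose_inv_of_posDef hC, dotProduct_comm]
  simp only [quad, mulVec_add, mulVec_smul, add_dotProduct, dotProduct_add, smul_dotProduct,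
    dotProduct_smul, smul_eq_mul, hs]
  ring

theorem quad_single (C : Matrix (Fin n) (Fin n) ℝ) (i : Fin n) :
    quad C (Pi.single i 1) = C⁻¹ i i := by
  simp [quad]

/-- Cauchy–Schwarz for `C⁻¹`: the quadratic `t ↦ quad C (z + t • v)` is nonnegative, so its
discriminant is not positive. -/
theorem sq_dotProduct_le {C : Matrix (Fin n) (Fin n) ℝ} (hC : C.PosDef) (z v : Fin n → ℝ) :
    (v ⬝ᵥ (C⁻¹ *ᵥ z)) ^ 2 ≤ quad C v * quad C z := by
  have h := discrim_le_zero (a := quad C v) (b := 2 * (v ⬝ᵥ (C⁻¹ *ᵥ z))) (c := quad C z)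
    fun t => by
      have h1 := quad_nonneg hC (z + t • v)
      rw [quad_add_smul hC] at h1
      linarith
  rw [discrim] at h
  linarith

/-- Cauchy–Schwarz with `v = C e_i`: then `v' C⁻¹ z = z_i` and `quad C v = C i i = 1`. The norm is
the sup norm. -/
theorem IsCorr.norm_sq_le_quad {C : Matrix (Fin n) (Fin n) ℝ} (hC : IsCorr C) (z : Fin n → ℝ) :
    ‖z‖ ^ 2 ≤ quad C z := by
  have hu : IsUnit C.det := hC.1.det_pos.ne'.isUnit
  have h0 := quad_nonneg hC.1 z
  have h1 : ‖z‖ ≤ Real.sqrt (quad C z) := by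
    rw [pi_norm_le_iff_of_nonneg (Real.sqrt_nonneg _)]
    intro i
    rw [Real.norm_eq_abs]
    apply Real.abs_le_sqrt
    have h2 := sq_dotProduct_le hC.1 z (C.col i)
    have h3 : C⁻¹ *ᵥ C.col i = Pi.single i 1 := by
      rw [← mulVec_single_one, mulVec_mulVec, nonsing_inv_mul _ hu, one_mulVec]
    have h4 : C.col i ⬝ᵥ (C⁻¹ *ᵥ z) = z i := by
      rw [dotProduct_mulVec, ← mulVec_transpose, transpose_inv_of_posDef hC.1, h3,
        single_one_dotProduct]
    have h5 : quad C (C.col i) = 1 := by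
      rw [quad, h3, dotProduct_single_one]
      exact hC.2 i
    rwa [h4, h5, one_mul] at h2
  calc ‖z‖ ^ 2 ≤ Real.sqrt (quad C z) ^ 2 := by gcongr
    _ = quad C z := Real.sq_sqrt h0

theorem abs_mulVec_mul_le {C : Matrix (Fin n) (Fin n) ℝ} (hC : C.PosDef) (z : Fin n → ℝ)
    (i j : Fin n) :
    |(C⁻¹ *ᵥ z) i * (C⁻¹ *ᵥ z) j| ≤ trace C⁻¹ * quad C z := by
  have h : ∀ k, ((C⁻¹ *ᵥ z) k) ^ 2 ≤ trace C⁻¹ * quad C z := by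
    intro k
    have h1 := sq_dotProduct_le hC z (Pi.single k 1)
    rw [single_one_dotProduct, quad_single] at h1
    have h2 : C⁻¹ k k ≤ trace C⁻¹ :=
      Finset.single_le_sum (f := fun k => C⁻¹ k k) (fun l _ => hC.inv.posSemidef.diag_nonneg)
        (Finset.mem_univ k)
    exact h1.trans (mul_le_mul_of_nonneg_right h2 (quad_nonneg hC z))
  have hi := h i
  have hj := h j
  rw [abs_le]
  constructor <;> nlinarith [sq_nonneg ((C⁻¹ *ᵥ z) i + (C⁻¹ *ᵥ z) j),
    sq_nonneg ((C⁻¹ *ᵥ z) i - (C⁻¹ *ᵥ z) j)]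

theorem abs_mulVec_le {C : Matrix (Fin n) (Fin n) ℝ} (hC : C.PosDef) (z : Fin n → ℝ)
    (i : Fin n) :
    |(C⁻¹ *ᵥ z) i| ≤ (1 + trace C⁻¹) * (1 + quad C z) := by
  have h := abs_mulVec_mul_le hC z i i
  have h1 := quad_nonneg hC z
  have h2 : 0 ≤ trace C⁻¹ := hC.inv.posSemidef.trace_nonneg
  rw [abs_mul] at h
  nlinarith [sq_nonneg (|(C⁻¹ *ᵥ z) i| - 1), mul_nonneg h2 h1]

theorem continuous_quad (C : Matrix (Fin n) (Fin n) ℝ) : Continuous (quad C) := by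
  unfold quad
  fun_prop

theorem hasLineDerivAt_quad {C : Matrix (Fin n) (Fin n) ℝ} (hC : C.PosDef) (z : Fin n → ℝ)
    (i : Fin n) :
    HasDerivAt (fun t : ℝ => quad C (z + t • Pi.single i 1)) (2 * (C⁻¹ *ᵥ z) i) 0 := by
  have h : (fun t : ℝ => quad C (z + t • Pi.single i 1)) =
      fun t => quad C z + t * (2 * (C⁻¹ *ᵥ z) i) + t ^ 2 * C⁻¹ i i := by
    funext t
    rw [quad_add_smul hC, quad_single, single_one_dotProduct]
  rw [h]
  have h1 := (((hasDerivAt_id (0 : ℝ)).mul_const (2 * (C⁻¹ *ᵥ z) i)).const_add (quad C z)).add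
    (((hasDerivAt_id (0 : ℝ)).pow 2).mul_const (C⁻¹ i i))
  convert! h1 using 1
  simp

theorem hasLineDerivAt_mulVec (C : Matrix (Fin n) (Fin n) ℝ) (z : Fin n → ℝ)
    (i j : Fin n) :
    HasDerivAt (fun t : ℝ => (C⁻¹ *ᵥ (z + t • Pi.single i 1)) j) (C⁻¹ j i) 0 := by
  have h : (fun t : ℝ => (C⁻¹ *ᵥ (z + t • Pi.single i 1)) j) =
      fun t => (C⁻¹ *ᵥ z) j + t * C⁻¹ j i := by
    funext t
    rw [mulVec_add, mulVec_smul, mulVec_single_one]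
    rfl
  rw [h]
  simpa using ((hasDerivAt_id (0 : ℝ)).mul_const (C⁻¹ j i)).const_add ((C⁻¹ *ᵥ z) j)

theorem continuous_mulVec_apply (A : Matrix (Fin n) (Fin n) ℝ) (i : Fin n) :
    Continuous fun z : Fin n → ℝ => (A *ᵥ z) i := by
  fun_prop

/-! ### Stein's identity and moments for elliptical densities -/

theorem integral_add_add_add {α : Type*} [MeasurableSpace α] {μ : Measure α} {a b c d : α → ℝ}
    (ha : Integrable a μ) (hb : Integrable b μ) (hc : Integrable c μ) (hd : Integrable d μ) :
    ∫ x, a x + b x + c x + d x ∂μ =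
      ∫ x, a x ∂μ + ∫ x, b x ∂μ + ∫ x, c x ∂μ + ∫ x, d x ∂μ := by
  rw [← integral_add ha hb, ← integral_add (f := fun x => a x + b x) (ha.add hb) hc,
    ← integral_add (f := fun x => a x + b x + c x) ((ha.add hb).add hc) hd]

/-- An elliptical density generator `F` with score weight `G`, where `G' = -(κ/2) G²`. -/
structure IsGenerator (C : Matrix (Fin n) (Fin n) ℝ) (κ : ℝ) (F G : ℝ → ℝ) : Prop where
  nonneg : 0 ≤ κ
  F_nonneg : ∀ q, 0 ≤ q → 0 ≤ F q
  G_nonneg : ∀ q, 0 ≤ q → 0 ≤ G q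
  hasDerivAt_F : ∀ q, 0 ≤ q → HasDerivAt F (-(G q / 2) * F q) q
  hasDerivAt_G : ∀ q, 0 ≤ q → HasDerivAt G (-(κ / 2) * G q ^ 2) q
  integrable : Integrable fun z : Fin n → ℝ =>
    F (quad C z) * ((1 + quad C z) * (1 + G (quad C z) * quad C z) ^ 2)
  integral_eq_one : ∫ z : Fin n → ℝ, F (quad C z) = 1

namespace IsGenerator

variable {C : Matrix (Fin n) (Fin n) ℝ} {κ : ℝ} {F G : ℝ → ℝ}

theorem continuous_F (h : IsGenerator C κ F G) (hC : C.PosDef) :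
    Continuous fun z => F (quad C z) :=
  continuous_iff_continuousAt.2 fun z => ContinuousAt.comp
    (h.hasDerivAt_F _ (quad_nonneg hC z)).continuousAt (continuous_quad C).continuousAt

theorem continuous_G (h : IsGenerator C κ F G) (hC : C.PosDef) :
    Continuous fun z => G (quad C z) :=
  continuous_iff_continuousAt.2 fun z => ContinuousAt.comp
    (h.hasDerivAt_G _ (quad_nonneg hC z)).continuousAt (continuous_quad C).continuousAt

/-- One dominating function serves all the moments: `1 + q` pays for an unweighted factor `y_k`, and
each factor `1 + G q` for a weighted pair `G y_i y_j`. -/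
theorem integrable_of_le (h : IsGenerator C κ F G) (hC : C.PosDef) {g : (Fin n → ℝ) → ℝ}
    (hg : Continuous g)
    (hle : ∀ z, |g z| ≤ (1 + trace C⁻¹) ^ 2 *
      ((1 + quad C z) * (1 + G (quad C z) * quad C z) ^ 2)) :
    Integrable fun z => F (quad C z) * g z := by
  refine Integrable.mono' (h.integrable.const_mul ((1 + trace C⁻¹) ^ 2))
    ((h.continuous_F hC).mul hg).aestronglyMeasurable (Eventually.of_forall fun z => ?_)
  have hF := h.F_nonneg _ (quad_nonneg hC z)
  rw [norm_mul, Real.norm_of_nonneg hF, Real.norm_eq_abs]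
  calc F (quad C z) * |g z| ≤ F (quad C z) * _ := mul_le_mul_of_nonneg_left (hle z) hF
    _ = _ := by ring

theorem hasLineDerivAt_F (h : IsGenerator C κ F G) (hC : C.PosDef) (z : Fin n → ℝ) (i : Fin n) :
    HasLineDerivAt ℝ (fun z => F (quad C z))
      (-(F (quad C z) * (G (quad C z) * (C⁻¹ *ᵥ z) i))) z (Pi.single i 1) := by
  have h1 := HasDerivAt.comp_of_eq (0 : ℝ) (h.hasDerivAt_F _ (quad_nonneg hC z))
    (hasLineDerivAt_quad hC z i) (by simp)
  rw [HasLineDerivAt]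
  refine h1.congr_deriv ?_
  ring

theorem hasLineDerivAt_G (h : IsGenerator C κ F G) (hC : C.PosDef) (z : Fin n → ℝ) (i : Fin n) :
    HasLineDerivAt ℝ (fun z => G (quad C z))
      (-(κ * (G (quad C z) ^ 2 * (C⁻¹ *ᵥ z) i))) z (Pi.single i 1) := by
  have h1 := HasDerivAt.comp_of_eq (0 : ℝ) (h.hasDerivAt_G _ (quad_nonneg hC z))
    (hasLineDerivAt_quad hC z i) (by simp)
  rw [HasLineDerivAt]
  refine h1.congr_deriv ?_
  ring

/-- Stein's identity for the elliptical density. -/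
theorem integral_score_mul (h : IsGenerator C κ F G) (hC : C.PosDef) (i : Fin n)
    {g g' : (Fin n → ℝ) → ℝ} (hg : ∀ z, HasLineDerivAt ℝ g (g' z) z (Pi.single i 1))
    (h1 : Integrable fun z => F (quad C z) * g z)
    (h2 : Integrable fun z => F (quad C z) * g' z)
    (h3 : Integrable fun z => F (quad C z) * (G (quad C z) * (C⁻¹ *ᵥ z) i * g z)) :
    ∫ z, F (quad C z) * (G (quad C z) * (C⁻¹ *ᵥ z) i * g z) = ∫ z, F (quad C z) * g' z := by
  -- Integration by parts along `e_i`; integrability of the three products removes the boundary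
  -- terms.
  have h4 := integral_bilinear_hasLineDerivAt_right_eq_neg_left_of_integrable
    (μ := (volume : Measure (Fin n → ℝ))) (B := ContinuousLinearMap.mul ℝ ℝ)
    (f := fun z => F (quad C z)) (g := g) (v := Pi.single i 1)
    (f' := fun z => -(F (quad C z) * (G (quad C z) * (C⁻¹ *ᵥ z) i))) (g' := g')
    (by
      convert h3.neg using 2 with z
      simp
      ring)
    h2 h1 (fun z _ => h.hasLineDerivAt_F hC z i) (fun z _ => hg z)
  simp only [ContinuousLinearMap.mul_apply'] at h4
  rw [h4, ← integral_neg]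
  refine integral_congr_ae (Eventually.of_forall fun z => ?_)
  simp only
  ring

theorem integrable_F (h : IsGenerator C κ F G) (hC : C.PosDef) :
    Integrable fun z => F (quad C z) := by
  have h1 := h.integrable_of_le hC (g := fun _ => 1) continuous_const fun z => ?_
  · simpa using h1
  · have hq := quad_nonneg hC z
    have hs := mul_nonneg (h.G_nonneg _ hq) hq
    have hT : 0 ≤ trace C⁻¹ := hC.inv.posSemidef.trace_nonneg
    rw [abs_one]
    exact one_le_mul_of_one_le_of_one_le (one_le_pow₀ (by linarith))
      (one_le_mul_of_one_le_of_one_le (by linarith) (one_le_pow₀ (by linarith)))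

theorem integrable_mulVec (h : IsGenerator C κ F G) (hC : C.PosDef) (i : Fin n) :
    Integrable fun z => F (quad C z) * (C⁻¹ *ᵥ z) i := by
  refine h.integrable_of_le hC (continuous_mulVec_apply _ i) fun z => ?_
  have hq := quad_nonneg hC z
  have hs := mul_nonneg (h.G_nonneg _ hq) hq
  have hT : 0 ≤ trace C⁻¹ := hC.inv.posSemidef.trace_nonneg
  refine (abs_mulVec_le hC z i).trans (mul_le_mul ?_ ?_ (by positivity) (by positivity))
  · nlinarith
  · exact le_mul_of_one_le_right (by positivity) (one_le_pow₀ (by linarith))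

theorem abs_weighted_le (h : IsGenerator C κ F G) (hC : C.PosDef) (z : Fin n → ℝ) (i j : Fin n) :
    |G (quad C z) * ((C⁻¹ *ᵥ z) i * (C⁻¹ *ᵥ z) j)| ≤
      trace C⁻¹ * (G (quad C z) * quad C z) := by
  have hG := h.G_nonneg _ (quad_nonneg hC z)
  rw [abs_mul, abs_of_nonneg hG]
  calc _ ≤ G (quad C z) * (trace C⁻¹ * quad C z) :=
        mul_le_mul_of_nonneg_left (abs_mulVec_mul_le hC z i j) hG
    _ = _ := by ring

theorem integrable_weighted (h : IsGenerator C κ F G) (hC : C.PosDef) (i j : Fin n) :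
    Integrable fun z => F (quad C z) * (G (quad C z) * ((C⁻¹ *ᵥ z) i * (C⁻¹ *ᵥ z) j)) := by
  refine h.integrable_of_le hC ((h.continuous_G hC).mul
    ((continuous_mulVec_apply _ i).mul (continuous_mulVec_apply _ j))) fun z => ?_
  have hq := quad_nonneg hC z
  have hs := mul_nonneg (h.G_nonneg _ hq) hq
  have hT : 0 ≤ trace C⁻¹ := hC.inv.posSemidef.trace_nonneg
  refine (h.abs_weighted_le hC z i j).trans (mul_le_mul ?_ ?_ hs (by positivity))
  · nlinarith
  · have h1 : G (quad C z) * quad C z ≤ (1 + G (quad C z) * quad C z) ^ 2 := by nlinarith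
    exact h1.trans (le_mul_of_one_le_left (by positivity) (by linarith))

theorem integrable_weighted_three (h : IsGenerator C κ F G) (hC : C.PosDef) (i j k : Fin n) :
    Integrable fun z => F (quad C z) *
      (G (quad C z) * ((C⁻¹ *ᵥ z) i * (C⁻¹ *ᵥ z) j) * (C⁻¹ *ᵥ z) k) := by
  refine h.integrable_of_le hC (((h.continuous_G hC).mul
    ((continuous_mulVec_apply _ i).mul (continuous_mulVec_apply _ j))).mul
      (continuous_mulVec_apply _ k)) fun z => ?_
  have hq := quad_nonneg hC z
  have hs := mul_nonneg (h.G_nonneg _ hq) hq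
  have hT : 0 ≤ trace C⁻¹ := hC.inv.posSemidef.trace_nonneg
  rw [abs_mul]
  calc _ ≤ (trace C⁻¹ * (G (quad C z) * quad C z)) * ((1 + trace C⁻¹) * (1 + quad C z)) :=
        mul_le_mul (h.abs_weighted_le hC z i j) (abs_mulVec_le hC z k) (abs_nonneg _)
          (by positivity)
    _ = (trace C⁻¹ * (1 + trace C⁻¹)) * ((1 + quad C z) * (G (quad C z) * quad C z)) := by ring
    _ ≤ _ := by
      refine mul_le_mul ?_ ?_ (by positivity) (by positivity)
      · nlinarith
      · refine mul_le_mul_of_nonneg_left ?_ (by positivity)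
        nlinarith

theorem integrable_weighted_four (h : IsGenerator C κ F G) (hC : C.PosDef) (i j k l : Fin n) :
    Integrable fun z => F (quad C z) *
      (G (quad C z) * ((C⁻¹ *ᵥ z) i * (C⁻¹ *ᵥ z) j) *
        (G (quad C z) * ((C⁻¹ *ᵥ z) k * (C⁻¹ *ᵥ z) l))) := by
  refine h.integrable_of_le hC (((h.continuous_G hC).mul
    ((continuous_mulVec_apply _ i).mul (continuous_mulVec_apply _ j))).mul
    ((h.continuous_G hC).mul
      ((continuous_mulVec_apply _ k).mul (continuous_mulVec_apply _ l)))) fun z => ?_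
  have hq := quad_nonneg hC z
  have hs := mul_nonneg (h.G_nonneg _ hq) hq
  have hT : 0 ≤ trace C⁻¹ := hC.inv.posSemidef.trace_nonneg
  rw [abs_mul]
  calc _ ≤ (trace C⁻¹ * (G (quad C z) * quad C z)) * (trace C⁻¹ * (G (quad C z) * quad C z)) :=
        mul_le_mul (h.abs_weighted_le hC z i j) (h.abs_weighted_le hC z k l) (abs_nonneg _)
          (by positivity)
    _ = trace C⁻¹ ^ 2 * (G (quad C z) * quad C z) ^ 2 := by ring
    _ ≤ _ := by
      refine mul_le_mul ?_ ?_ (by positivity) (by positivity)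
      · nlinarith
      · refine le_trans ?_ (le_mul_of_one_le_left (by positivity) (by linarith))
        gcongr
        linarith

theorem integral_weighted (h : IsGenerator C κ F G) (hC : C.PosDef) (i j : Fin n) :
    ∫ z, F (quad C z) * (G (quad C z) * ((C⁻¹ *ᵥ z) i * (C⁻¹ *ᵥ z) j)) = C⁻¹ j i := by
  have h1 := h.integral_score_mul hC i (g := fun z => (C⁻¹ *ᵥ z) j) (g' := fun _ => C⁻¹ j i)
    (fun z => hasLineDerivAt_mulVec C z i j) (h.integrable_mulVec hC j)
    ((h.integrable_F hC).mul_const _)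
    (by simpa only [mul_assoc] using h.integrable_weighted hC i j)
  rw [integral_mul_const, h.integral_eq_one, one_mul] at h1
  simpa only [mul_assoc] using h1

/-- Stein's identity with `g = G y_j y_k y_l`. Differentiating `G` returns `-κ` times the same
integral, whence the factor `(1 + κ)⁻¹`; the other terms are second moments. -/
theorem integral_weighted_four (h : IsGenerator C κ F G) (hC : C.PosDef) (i j k l : Fin n) :
    ∫ z, F (quad C z) * (G (quad C z) * ((C⁻¹ *ᵥ z) i * (C⁻¹ *ᵥ z) j) *
        (G (quad C z) * ((C⁻¹ *ᵥ z) k * (C⁻¹ *ᵥ z) l))) =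
      (1 + κ)⁻¹ * (C⁻¹ j i * C⁻¹ l k + C⁻¹ k i * C⁻¹ l j + C⁻¹ l i * C⁻¹ k j) := by
  set J := ∫ z, F (quad C z) * (G (quad C z) * ((C⁻¹ *ᵥ z) i * (C⁻¹ *ᵥ z) j) *
        (G (quad C z) * ((C⁻¹ *ᵥ z) k * (C⁻¹ *ᵥ z) l))) with hJ
  have I4 := h.integrable_weighted_four hC i j k l
  have Ikl := (h.integrable_weighted hC k l).mul_const (C⁻¹ j i)
  have Ijl := (h.integrable_weighted hC j l).mul_const (C⁻¹ k i)
  have Ijk := (h.integrable_weighted hC j k).mul_const (C⁻¹ l i)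
  have I4' := I4.const_mul (-κ)
  have hder : ∀ z, HasLineDerivAt ℝ
      (fun z => G (quad C z) * ((C⁻¹ *ᵥ z) j * (C⁻¹ *ᵥ z) k) * (C⁻¹ *ᵥ z) l)
      (-κ * (G (quad C z) * ((C⁻¹ *ᵥ z) i * (C⁻¹ *ᵥ z) j) *
        (G (quad C z) * ((C⁻¹ *ᵥ z) k * (C⁻¹ *ᵥ z) l))) +
        (G (quad C z) * ((C⁻¹ *ᵥ z) k * (C⁻¹ *ᵥ z) l)) * C⁻¹ j i +
        (G (quad C z) * ((C⁻¹ *ᵥ z) j * (C⁻¹ *ᵥ z) l)) * C⁻¹ k i +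
        (G (quad C z) * ((C⁻¹ *ᵥ z) j * (C⁻¹ *ᵥ z) k)) * C⁻¹ l i) z (Pi.single i 1) := by
    intro z
    have h1 := HasDerivAt.mul (HasDerivAt.mul (h.hasLineDerivAt_G hC z i)
      (HasDerivAt.mul (hasLineDerivAt_mulVec C z i j) (hasLineDerivAt_mulVec C z i k)))
      (hasLineDerivAt_mulVec C z i l)
    rw [HasLineDerivAt]
    refine h1.congr_deriv ?_
    simp only [Pi.mul_apply, zero_smul, add_zero]
    ring
  have hF' : ∀ z, F (quad C z) * (-κ * (G (quad C z) * ((C⁻¹ *ᵥ z) i * (C⁻¹ *ᵥ z) j) *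
        (G (quad C z) * ((C⁻¹ *ᵥ z) k * (C⁻¹ *ᵥ z) l))) +
        (G (quad C z) * ((C⁻¹ *ᵥ z) k * (C⁻¹ *ᵥ z) l)) * C⁻¹ j i +
        (G (quad C z) * ((C⁻¹ *ᵥ z) j * (C⁻¹ *ᵥ z) l)) * C⁻¹ k i +
        (G (quad C z) * ((C⁻¹ *ᵥ z) j * (C⁻¹ *ᵥ z) k)) * C⁻¹ l i) =
      -κ * (F (quad C z) * (G (quad C z) * ((C⁻¹ *ᵥ z) i * (C⁻¹ *ᵥ z) j) *
        (G (quad C z) * ((C⁻¹ *ᵥ z) k * (C⁻¹ *ᵥ z) l)))) +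
      F (quad C z) * (G (quad C z) * ((C⁻¹ *ᵥ z) k * (C⁻¹ *ᵥ z) l)) * C⁻¹ j i +
      F (quad C z) * (G (quad C z) * ((C⁻¹ *ᵥ z) j * (C⁻¹ *ᵥ z) l)) * C⁻¹ k i +
      F (quad C z) * (G (quad C z) * ((C⁻¹ *ᵥ z) j * (C⁻¹ *ᵥ z) k)) * C⁻¹ l i := by
    intro z; ring
  have hIg : ∀ z, G (quad C z) * (C⁻¹ *ᵥ z) i *
      (G (quad C z) * ((C⁻¹ *ᵥ z) j * (C⁻¹ *ᵥ z) k) * (C⁻¹ *ᵥ z) l) =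
      G (quad C z) * ((C⁻¹ *ᵥ z) i * (C⁻¹ *ᵥ z) j) *
        (G (quad C z) * ((C⁻¹ *ᵥ z) k * (C⁻¹ *ᵥ z) l)) := by
    intro z; ring
  have h1 := h.integral_score_mul hC i hder (h.integrable_weighted_three hC j k l)
    (by simp only [hF']; exact ((I4'.add Ikl).add Ijl).add Ijk)
    (by simp only [hIg]; exact I4)
  simp only [hIg, hF'] at h1
  rw [integral_add_add_add I4' Ikl Ijl Ijk, integral_const_mul, integral_mul_const, integral_mul_const,
    integral_mul_const, h.integral_weighted hC, h.integral_weighted hC, h.integral_weighted hC,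
    ← hJ] at h1
  have hκ : 1 + κ ≠ 0 := by have := h.nonneg; positivity
  rw [eq_inv_mul_iff_mul_eq₀ hκ]
  linarith

theorem integrable_centered (h : IsGenerator C κ F G) (hC : C.PosDef) (i j k l : Fin n) :
    Integrable fun z => F (quad C z) *
      ((G (quad C z) * ((C⁻¹ *ᵥ z) i * (C⁻¹ *ᵥ z) j) - C⁻¹ i j) *
        (G (quad C z) * ((C⁻¹ *ᵥ z) k * (C⁻¹ *ᵥ z) l) - C⁻¹ k l)) := by
  have h1 := (((h.integrable_weighted_four hC i j k l).sub
    ((h.integrable_weighted hC i j).mul_const (C⁻¹ k l))).sub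
    ((h.integrable_weighted hC k l).mul_const (C⁻¹ i j))).add
    ((h.integrable_F hC).mul_const (C⁻¹ i j * C⁻¹ k l))
  refine h1.congr (Eventually.of_forall fun z => ?_)
  simp only [Pi.add_apply, Pi.sub_apply]
  ring

/-- Centering changes only the pairing `C⁻¹ i j * C⁻¹ k l`: its coefficient becomes `(1 + κ)⁻¹ - 2 +
1`. -/
theorem integral_centered (h : IsGenerator C κ F G) (hC : C.PosDef) (i j k l : Fin n) :
    ∫ z, F (quad C z) *
      ((G (quad C z) * ((C⁻¹ *ᵥ z) i * (C⁻¹ *ᵥ z) j) - C⁻¹ i j) *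
        (G (quad C z) * ((C⁻¹ *ᵥ z) k * (C⁻¹ *ᵥ z) l) - C⁻¹ k l)) =
      (1 + κ)⁻¹ * (C⁻¹ i k * C⁻¹ j l + C⁻¹ i l * C⁻¹ j k) +
        ((1 + κ)⁻¹ - 1) * (C⁻¹ i j * C⁻¹ k l) := by
  have hs : ∀ a b, C⁻¹ a b = C⁻¹ b a := fun a b =>
    (congrFun (congrFun (transpose_inv_of_posDef hC) a) b).symm
  have I4 := h.integrable_weighted_four hC i j k l
  have I1 := (h.integrable_weighted hC i j).mul_const (-C⁻¹ k l)
  have I2 := (h.integrable_weighted hC k l).mul_const (-C⁻¹ i j)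
  have I0 := (h.integrable_F hC).mul_const (C⁻¹ i j * C⁻¹ k l)
  have h1 : ∀ z, F (quad C z) *
      ((G (quad C z) * ((C⁻¹ *ᵥ z) i * (C⁻¹ *ᵥ z) j) - C⁻¹ i j) *
        (G (quad C z) * ((C⁻¹ *ᵥ z) k * (C⁻¹ *ᵥ z) l) - C⁻¹ k l)) =
      F (quad C z) * (G (quad C z) * ((C⁻¹ *ᵥ z) i * (C⁻¹ *ᵥ z) j) *
        (G (quad C z) * ((C⁻¹ *ᵥ z) k * (C⁻¹ *ᵥ z) l))) +
      F (quad C z) * (G (quad C z) * ((C⁻¹ *ᵥ z) i * (C⁻¹ *ᵥ z) j)) * (-C⁻¹ k l) +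
      F (quad C z) * (G (quad C z) * ((C⁻¹ *ᵥ z) k * (C⁻¹ *ᵥ z) l)) * (-C⁻¹ i j) +
      F (quad C z) * (C⁻¹ i j * C⁻¹ k l) := by
    intro z; ring
  simp only [h1]
  rw [integral_add_add_add I4 I1 I2 I0, integral_mul_const, integral_mul_const, integral_mul_const, h.integral_weighted_four hC,
    h.integral_weighted hC, h.integral_weighted hC, h.integral_eq_one, hs j i, hs l k, hs k i,
    hs l j, hs l i, hs k j]
  ring

end IsGenerator

/-! ### From moments to the information matrix -/

theorem integral_eq_one_of_isProbabilityMeasure_lawOf {f : (Fin n → ℝ) → ℝ} (hf : Continuous f)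
    (hf0 : ∀ z, 0 ≤ f z) [IsProbabilityMeasure (lawOf f)] : ∫ z, f z = 1 := by
  have h1 : lawOf f Set.univ = 1 := measure_univ
  rw [lawOf, withDensity_apply _ MeasurableSet.univ, setLIntegral_univ] at h1
  rw [integral_eq_lintegral_of_nonneg_ae (Eventually.of_forall hf0) hf.aestronglyMeasurable, h1]
  simp

theorem integrable_lawOf_iff {f : (Fin n → ℝ) → ℝ} (hf : Continuous f) (hf0 : ∀ z, 0 ≤ f z)
    {g : (Fin n → ℝ) → ℝ} : Integrable g (lawOf f) ↔ Integrable fun z => f z * g z := by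
  rw [lawOf, integrable_withDensity_iff_integrable_smul' hf.measurable.ennreal_ofReal
    (Eventually.of_forall fun _ => ENNReal.ofReal_lt_top)]
  simp only [ENNReal.toReal_ofReal (hf0 _), smul_eq_mul]

theorem integral_lawOf {f : (Fin n → ℝ) → ℝ} (hf : Continuous f) (hf0 : ∀ z, 0 ≤ f z)
    (g : (Fin n → ℝ) → ℝ) : ∫ z, g z ∂lawOf f = ∫ z, f z * g z := by
  rw [lawOf, integral_withDensity_eq_integral_toReal_smul hf.measurable.ennreal_ofReal
    (Eventually.of_forall fun _ => ENNReal.ofReal_lt_top)]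
  simp only [ENNReal.toReal_ofReal (hf0 _), smul_eq_mul]

theorem infoFormula_apply {C : Matrix (Fin n) (Fin n) ℝ} (φ : ℝ) (k l : LowIdx n) :
    infoFormula φ C k l = ∑ p : Fin n × Fin n, ∑ q : Fin n × Fin n,
      1 / 4 * (MM C p k * MM C q l) *
        (φ * (C⁻¹ p.1 q.1 * C⁻¹ p.2 q.2 + C⁻¹ p.1 q.2 * C⁻¹ p.2 q.1) +
          (φ - 1) * (C⁻¹ p.2 p.1 * C⁻¹ q.2 q.1)) := by
  have hK : ∀ p q : Fin n × Fin n, ((C ⊗ₖ C)⁻¹ * Hn n) p q =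
      C⁻¹ p.1 q.1 * C⁻¹ p.2 q.2 + C⁻¹ p.1 q.2 * C⁻¹ p.2 q.1 := by
    intro p q
    -- Right multiplication by `K_n` swaps the two components of the column index.
    rw [Hn, mul_add, mul_one, inv_kronecker, Matrix.add_apply, kroneckerMap_apply, mul_apply,
      Finset.sum_eq_single q.swap]
    · simp [Kn]
    · intro r _ hr
      have : q ≠ r.swap := fun h => hr (by rw [h, Prod.swap_swap])
      simp [Kn, this]
    · simp
  simp only [infoFormula, Matrix.smul_apply, smul_eq_mul]
  rw [mul_apply, Finset.sum_comm, Finset.mul_sum]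
  refine Finset.sum_congr rfl fun q _ => ?_
  rw [mul_apply, Finset.sum_mul, Finset.mul_sum]
  refine Finset.sum_congr rfl fun p _ => ?_
  rw [transpose_apply, Matrix.add_apply, Matrix.smul_apply, Matrix.smul_apply, hK,
    vecMulVec_apply]
  simp only [smul_eq_mul, vec]
  ring

theorem mul_scoreFormula_mul {C : Matrix (Fin n) (Fin n) ℝ} {F G : ℝ → ℝ}
    (hC : C.PosDef) (k l : LowIdx n) (z : Fin n → ℝ) :
    F (quad C z) * (scoreFormula (G (quad C z)) C z k * scoreFormula (G (quad C z)) C z l) =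
      ∑ p : Fin n × Fin n, ∑ q : Fin n × Fin n, 1 / 4 * (MM C p k * MM C q l) *
        (F (quad C z) *
      ((G (quad C z) * ((C⁻¹ *ᵥ z) p.1 * (C⁻¹ *ᵥ z) p.2) - C⁻¹ p.1 p.2) *
        (G (quad C z) * ((C⁻¹ *ᵥ z) q.1 * (C⁻¹ *ᵥ z) q.2) - C⁻¹ q.1 q.2))) := by
  rw [scoreFormula_apply hC, scoreFormula_apply hC, mul_mul_mul_comm, Finset.sum_mul_sum,
    Finset.mul_sum, Finset.mul_sum]
  refine Finset.sum_congr rfl fun p _ => ?_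
  rw [Finset.mul_sum, Finset.mul_sum]
  refine Finset.sum_congr rfl fun q _ => ?_
  ring

theorem IsGenerator.infoMatrix_eq {C : Matrix (Fin n) (Fin n) ℝ} {κ : ℝ} {F G : ℝ → ℝ}
    (h : IsGenerator C κ F G) (hC : C.PosDef)
    {f : Matrix (Fin n) (Fin n) ℝ → (Fin n → ℝ) → ℝ} (hf : ∀ z, f C z = F (quad C z))
    (hscore : ∀ z, score f C z = scoreFormula (G (quad C z)) C z)
    {Ω : Type*} [MeasurableSpace Ω] {P : Measure Ω} {Z : Ω → Fin n → ℝ}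
    (hZ : HasLaw Z (lawOf (f C)) P) :
    (∀ k l, Integrable (fun ω => score f C (Z ω) k * score f C (Z ω) l) P) ∧
      infoMatrix P (fun ω => score f C (Z ω)) = infoFormula (1 + κ)⁻¹ C := by
  have hfC : f C = fun z => F (quad C z) := funext hf
  have hcont := h.continuous_F hC
  have hnn : ∀ z, 0 ≤ F (quad C z) := fun z => h.F_nonneg _ (quad_nonneg hC z)
  have hint : ∀ k l, Integrable (fun z => scoreFormula (G (quad C z)) C z k *
      scoreFormula (G (quad C z)) C z l) (lawOf (f C)) := by
    intro k l
    rw [hfC, integrable_lawOf_iff hcont hnn]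
    simp only [mul_scoreFormula_mul hC]
    exact integrable_finsetSum _ fun p _ => integrable_finsetSum _ fun q _ =>
      (h.integrable_centered hC _ _ _ _).const_mul _
  simp only [hscore]
  refine ⟨fun k l => ?_, ?_⟩
  · have h1 := hint k l
    rw [← hZ.map_eq] at h1
    exact h1.comp_aemeasurable hZ.aemeasurable
  · ext k l
    rw [infoMatrix, of_apply]
    have h1 := hZ.integral_comp (hint k l).aestronglyMeasurable
    simp only [Function.comp_def] at h1
    rw [h1, hfC, integral_lawOf hcont hnn]
    simp only [mul_scoreFormula_mul hC]
    rw [integral_finsetSum _ fun p _ => integrable_finsetSum _ fun q _ =>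
      (h.integrable_centered hC _ _ _ _).const_mul _, infoFormula_apply]
    refine Finset.sum_congr rfl fun p _ => ?_
    rw [integral_finsetSum _ fun q _ => (h.integrable_centered hC _ _ _ _).const_mul _]
    refine Finset.sum_congr rfl fun q _ => ?_
    have hs : ∀ a b, C⁻¹ a b = C⁻¹ b a := fun a b =>
      (congrFun (congrFun (transpose_inv_of_posDef hC) a) b).symm
    rw [integral_const_mul, h.integral_centered hC, hs p.2 p.1, hs q.2 q.1]

/-! ### The Gaussian and `t` generators -/

theorem integrable_of_le_one_add_quad_rpow {C : Matrix (Fin n) (Fin n) ℝ} (hC : IsCorr C)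
    {s K : ℝ} (hs : (n : ℝ) < s) {h : (Fin n → ℝ) → ℝ} (hh : Continuous h)
    (hle : ∀ z, |h z| ≤ K * (1 + quad C z) ^ (-s / 2)) : Integrable h := by
  have hs0 : 0 < s := lt_of_le_of_lt (Nat.cast_nonneg n) hs
  have hK : 0 ≤ K := by
    have h1 := (abs_nonneg _).trans (hle 0)
    exact nonneg_of_mul_nonneg_left h1
      (Real.rpow_pos_of_pos (by have := quad_nonneg hC.1 0; linarith) _)
  have h1 := integrable_rpow_neg_one_add_norm_sq (E := Fin n → ℝ) (μ := volume) (r := s)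
    (by simpa using hs)
  refine Integrable.mono' (h1.const_mul K) hh.aestronglyMeasurable
    (Eventually.of_forall fun z => ?_)
  refine (hle z).trans (mul_le_mul_of_nonneg_left ?_ hK)
  have h2 := hC.norm_sq_le_quad z
  exact Real.rpow_le_rpow_of_nonpos (by positivity) (by linarith) (by linarith)

theorem isGenerator_gauss {C : Matrix (Fin n) (Fin n) ℝ} (hC : IsCorr C)
    [IsProbabilityMeasure (lawOf (gaussDensity C))] :
    IsGenerator C 0 (fun q => (2 * Real.pi) ^ (-(n : ℝ) / 2) * C.det ^ (-(1 : ℝ) / 2) *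
      Real.exp (-q / 2)) (fun _ => 1) := by
  have hdet := hC.1.det_pos
  set K := (2 * Real.pi) ^ (-(n : ℝ) / 2) * C.det ^ (-(1 : ℝ) / 2) with hK
  have hK0 : 0 ≤ K := by positivity
  refine ⟨le_rfl, fun q _ => by positivity, fun _ _ => zero_le_one, fun q _ => ?_, fun q _ => ?_,
    ?_, ?_⟩
  · have h1 := (((hasDerivAt_id q).neg.div_const 2).exp).const_mul K
    refine h1.congr_deriv ?_
    simp only [id, Pi.neg_apply]
    ring
  · simpa using hasDerivAt_const q (1 : ℝ)
  -- The weight is at most `(1 + q)^3`, and the target decay is `(1 + q)^(-(n + 1))`, hence the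
  -- power `n + 4`. The constant comes from `x^m / m! ≤ exp x` at `x = (1 + q) / 2`.
  · refine integrable_of_le_one_add_quad_rpow hC (s := 2 * (n + 1))
      (K := K * (2 ^ (n + 4) * (n + 4).factorial * Real.exp (1 / 2))) (by linarith) ?_ fun z => ?_
    · have := continuous_quad C
      fun_prop
    · have hq := quad_nonneg hC.1 z
      generalize quad C z = q at hq
      have hq1 : 0 < 1 + q := by linarith
      have h1 := Real.pow_div_factorial_le_exp ((1 + q) / 2) (by positivity) (n + 4)
      have h2 : (1 + q) ^ (-(2 * ((n : ℝ) + 1)) / 2) = ((1 + q) ^ (n + 1))⁻¹ := by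
        rw [← Real.rpow_natCast, ← Real.rpow_neg hq1.le]
        congr 1
        push_cast
        ring
      have h3 : Real.exp ((1 + q) / 2) * Real.exp (-q / 2) = Real.exp (1 / 2) := by
        rw [← Real.exp_add]; congr 1; ring
      have h4 : (1 + q) ^ (n + 4) * Real.exp (-q / 2) ≤
          2 ^ (n + 4) * (n + 4).factorial * Real.exp (1 / 2) := by
        rw [div_pow, div_div, div_le_iff₀ (by positivity)] at h1
        calc _ ≤ (Real.exp ((1 + q) / 2) * (2 ^ (n + 4) * (n + 4).factorial)) *
              Real.exp (-q / 2) := by gcongr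
          _ = 2 ^ (n + 4) * (n + 4).factorial *
              (Real.exp ((1 + q) / 2) * Real.exp (-q / 2)) := by ring
          _ = _ := by rw [h3]
      rw [abs_of_nonneg (by positivity), h2, one_mul, ← div_eq_mul_inv,
        le_div_iff₀ (by positivity)]
      calc _ = K * ((1 + q) ^ (n + 4) * Real.exp (-q / 2)) := by ring
        _ ≤ _ := mul_le_mul_of_nonneg_left h4 hK0
  · have h1 := integral_eq_one_of_isProbabilityMeasure_lawOf (f := gaussDensity C) ?_ ?_
    · exact h1
    · have := continuous_quad C
      unfold gaussDensity
      fun_prop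
    · intro z
      unfold gaussDensity
      positivity

theorem isGenerator_t {C : Matrix (Fin n) (Fin n) ℝ} (hC : IsCorr C) {ν : ℝ} (hν : 2 < ν)
    [IsProbabilityMeasure (lawOf (tDensity ν C))] :
    IsGenerator C (2 / (ν + n)) (fun q => Real.Gamma ((ν + n) / 2) / Real.Gamma (ν / 2) *
      ((ν - 2) * Real.pi) ^ (-(n : ℝ) / 2) * C.det ^ (-(1 : ℝ) / 2) *
        (1 + q / (ν - 2)) ^ (-(ν + n) / 2)) (fun q => (ν + n) / (ν - 2 + q)) := by
  have hdet := hC.1.det_pos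
  have hν' : 0 < ν - 2 := by linarith
  have hG1 := Real.Gamma_pos_of_pos (show 0 < (ν + n) / 2 by positivity)
  have hG2 := Real.Gamma_pos_of_pos (show 0 < ν / 2 by positivity)
  set K := Real.Gamma ((ν + n) / 2) / Real.Gamma (ν / 2) *
      ((ν - 2) * Real.pi) ^ (-(n : ℝ) / 2) * C.det ^ (-(1 : ℝ) / 2) with hK
  have hK0 : 0 ≤ K := by positivity
  have hcont : Continuous (tDensity ν C) := by
    have hq := continuous_quad C
    unfold tDensity
    refine continuous_const.mul (Continuous.rpow_const (by fun_prop) fun z => Or.inl ?_)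
    have := quad_nonneg hC.1 z
    positivity
  have hnn : ∀ z, 0 ≤ tDensity ν C z := by
    intro z
    have := quad_nonneg hC.1 z
    unfold tDensity
    positivity
  refine ⟨by positivity, fun q hq => by positivity, fun q hq => by positivity, fun q hq => ?_,
    fun q hq => ?_, ?_, ?_⟩
  rotate_right
  · exact integral_eq_one_of_isProbabilityMeasure_lawOf (f := tDensity ν C) hcont hnn
  · have hb : 0 < 1 + q / (ν - 2) := by positivity
    have h1 := ((((hasDerivAt_id q).div_const (ν - 2)).const_add 1).rpow_const
      (p := -(ν + n) / 2) (Or.inl hb.ne')).const_mul K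
    refine h1.congr_deriv ?_
    have h2 : 0 < ν - 2 + q := by positivity
    simp only [id]
    rw [Real.rpow_sub_one hb.ne']
    field_simp
  · have h2 : 0 < ν - 2 + q := by positivity
    have h1 := (hasDerivAt_const q (ν + n)).div ((hasDerivAt_id q).const_add (ν - 2)) h2.ne'
    refine h1.congr_deriv ?_
    simp only [id]
    field_simp
    ring
  -- The factor `1 + q` lowers the decay exponent from `ν + n` to `ν + n - 2`, which exceeds `n`
  -- exactly because `ν > 2`. The constant combines `1 + q/(ν-2) ≥ (1+q)/(ν-1)` with `G q ≤ ν + n`.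
  · refine integrable_of_le_one_add_quad_rpow hC (s := ν + n - 2)
      (K := K * (ν - 1) ^ ((ν + n) / 2) * (1 + (ν + n)) ^ 2) (by linarith) ?_ fun z => ?_
    · refine hcont.mul ?_
      have hq := continuous_quad C
      have : Continuous fun z => (ν + n) / (ν - 2 + quad C z) :=
        continuous_const.div (by fun_prop) fun z => by
          have := quad_nonneg hC.1 z
          positivity
      fun_prop
    · have hq := quad_nonneg hC.1 z
      generalize quad C z = q at hq
      have hq1 : 0 < 1 + q := by linarith
      have hb : 0 < 1 + q / (ν - 2) := by positivity
      have hd : 0 < ν - 2 + q := by positivity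
      have h1 : (1 + q) / (ν - 1) ≤ 1 + q / (ν - 2) := by
        rw [div_le_iff₀ (by linarith)]
        have : q / (ν - 2) * (ν - 1) = q + q / (ν - 2) := by field_simp; ring
        have h0 : 0 ≤ q / (ν - 2) := by positivity
        nlinarith
      have hν1 : 0 < ν - 1 := by linarith
      have h2 : (1 + q / (ν - 2)) ^ (-(ν + n) / 2) ≤
          (ν - 1) ^ ((ν + n) / 2) * (1 + q) ^ (-(ν + n) / 2) := by
        have h3 := Real.rpow_le_rpow_of_nonpos (z := -(ν + n) / 2) (by positivity) h1
          (div_nonpos_of_nonpos_of_nonneg (neg_nonpos.2 (by positivity)) zero_le_two)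
        refine h3.trans_eq ?_
        rw [Real.div_rpow hq1.le hν1.le, neg_div, Real.rpow_neg hν1.le, div_inv_eq_mul, mul_comm]
      have h4 : (ν + n) / (ν - 2 + q) * q ≤ ν + n := by
        rw [div_mul_eq_mul_div, div_le_iff₀ hd]
        refine mul_le_mul_of_nonneg_left (by linarith) (by positivity)
      have h5 : (1 + q) ^ (-(ν + n - 2) / 2) = (1 + q) ^ (-(ν + n) / 2) * (1 + q) := by
        rw [← Real.rpow_add_one hq1.ne']
        congr 1
        ring
      rw [abs_of_nonneg (by positivity), h5]
      calc _ ≤ K * ((ν - 1) ^ ((ν + n) / 2) * (1 + q) ^ (-(ν + n) / 2)) *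
            ((1 + q) * (1 + (ν + n)) ^ 2) := by gcongr
        _ = _ := by ring

/-! ### Limits as `ν → ∞`, and the main theorem -/

theorem tendsto_WW (C : Matrix (Fin n) (Fin n) ℝ) (z : Fin n → ℝ) :
    Tendsto (fun ν : ℝ => WW ν C z) atTop (𝓝 1) := by
  have h1 : Tendsto (fun ν : ℝ => 1 + (n + 2 - quad C z) / (ν - 2 + quad C z)) atTop
      (𝓝 (1 + 0)) := by
    refine tendsto_const_nhds.add (Tendsto.div_atTop tendsto_const_nhds ?_)
    refine tendsto_atTop_add_const_right _ _ ?_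
    simpa only [sub_eq_add_neg, id] using tendsto_atTop_add_const_right atTop (-2 : ℝ)
      (tendsto_id (α := ℝ))
  rw [add_zero] at h1
  refine h1.congr' ?_
  filter_upwards [eventually_gt_atTop (2 - quad C z)] with ν hν
  have h2 : ν - 2 + quad C z ≠ 0 := by linarith
  rw [WW]
  field_simp
  ring

theorem tendsto_phi : Tendsto (fun ν : ℝ => phi n ν) atTop (𝓝 1) := by
  have h1 : Tendsto (fun ν : ℝ => 1 - 2 / (ν + n + 2)) atTop (𝓝 (1 - 0)) := by
    refine tendsto_const_nhds.sub (Tendsto.div_atTop tendsto_const_nhds ?_)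
    exact tendsto_atTop_add_const_right _ _ (tendsto_atTop_add_const_right _ _ tendsto_id)
  rw [sub_zero] at h1
  refine h1.congr' ?_
  filter_upwards [eventually_gt_atTop 0] with ν hν
  have h2 : ν + n + 2 ≠ 0 := by positivity
  rw [phi]
  field_simp
  ring

end CorrScore

theorem theorem1 {n : ℕ} (C : Matrix (Fin n) (Fin n) ℝ) (hC : CorrScore.IsCorr C)
    (ν : ℝ) (hν : 2 < ν)
    {Ω : Type*} [MeasurableSpace Ω] (P : Measure Ω) [IsProbabilityMeasure P]
    (Z : Ω → Fin n → ℝ) :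
    -- near `γ(C)` the parametrization is well defined, and it gives back `C` at `γ(C)`
    ((∀ᶠ g in 𝓝 (CorrScore.gam C),
        ∃! C' : Matrix (Fin n) (Fin n) ℝ, CorrScore.IsCorr C' ∧ CorrScore.gam C' = g) ∧
      CorrScore.corrOf (CorrScore.gam C) = C) ∧
    -- `Γ`: `C = exp(log C)`, the derivative exists and has the spectral expression
    (NormedSpace.exp (CorrScore.logM C) = C ∧
      DifferentiableAt ℝ
        (fun v : Fin n × Fin n → ℝ => (NormedSpace.exp (CorrScore.unvec v)).vec)
        (CorrScore.logM C).vec ∧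
      ∀ (Q : Matrix (Fin n) (Fin n) ℝ) (l : Fin n → ℝ), Qᵀ * Q = 1 →
        CorrScore.logM C = Q * Matrix.diagonal l * Qᵀ →
        CorrScore.Gam C = (Q ⊗ₖ Q) * CorrScore.Xi l * (Q ⊗ₖ Q)ᵀ) ∧
    -- `M`: the derivative exists and is given explicitly through `Γ`
    (DifferentiableAt ℝ (fun g => (CorrScore.corrOf g).vec) (CorrScore.gam C) ∧
      IsUnit (CorrScore.Ed n * CorrScore.Gam C * (CorrScore.Ed n)ᵀ).det ∧
      CorrScore.MM C =
        (CorrScore.El n + CorrScore.Eu n)ᵀ * CorrScore.El n *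
          (1 - CorrScore.Gam C * (CorrScore.Ed n)ᵀ *
            (CorrScore.Ed n * CorrScore.Gam C * (CorrScore.Ed n)ᵀ)⁻¹ * CorrScore.Ed n) *
          CorrScore.Gam C * (CorrScore.El n + CorrScore.Eu n)ᵀ) ∧
    -- score of the `t` distribution
    (∀ z : Fin n → ℝ,
      DifferentiableAt ℝ (CorrScore.logLik (CorrScore.tDensity ν) z) (CorrScore.gam C) ∧
      CorrScore.score (CorrScore.tDensity ν) C z =
        CorrScore.scoreFormula (CorrScore.WW ν C z) C z) ∧
    -- information matrix of the `t` distribution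
    (HasLaw Z (CorrScore.lawOf (CorrScore.tDensity ν C)) P →
      (∀ k l, Integrable (fun ω => CorrScore.score (CorrScore.tDensity ν) C (Z ω) k *
        CorrScore.score (CorrScore.tDensity ν) C (Z ω) l) P) ∧
      CorrScore.infoMatrix P (fun ω => CorrScore.score (CorrScore.tDensity ν) C (Z ω)) =
        CorrScore.infoFormula (CorrScore.phi n ν) C) ∧
    -- score of the Gaussian distribution: `W = 1`
    (∀ z : Fin n → ℝ,
      DifferentiableAt ℝ (CorrScore.logLik CorrScore.gaussDensity z) (CorrScore.gam C) ∧
      CorrScore.score CorrScore.gaussDensity C z = CorrScore.scoreFormula 1 C z) ∧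
    -- information matrix of the Gaussian distribution: `φ = 1`
    (HasLaw Z (CorrScore.lawOf (CorrScore.gaussDensity C)) P →
      (∀ k l, Integrable (fun ω => CorrScore.score CorrScore.gaussDensity C (Z ω) k *
        CorrScore.score CorrScore.gaussDensity C (Z ω) l) P) ∧
      CorrScore.infoMatrix P (fun ω => CorrScore.score CorrScore.gaussDensity C (Z ω)) =
        CorrScore.infoFormula 1 C) ∧
    -- the values `W = φ = 1` are the limits as `ν → ∞`
    ((∀ z : Fin n → ℝ, Tendsto (fun ν' : ℝ => CorrScore.WW ν' C z) atTop (𝓝 1)) ∧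
      Tendsto (fun ν' : ℝ => CorrScore.phi n ν') atTop (𝓝 1)) := by
  have hΓ := CorrScore.posDef_Gam_of_isCorr C
  refine ⟨⟨CorrScore.eventually_existsUnique_isCorr hC, CorrScore.corrOf_gam hC⟩,
    ⟨CorrScore.exp_logM hC.1, (CorrScore.hasStrictFDerivAt_vecExp _).hasFDerivAt.differentiableAt,
      fun Q l hQ hl => CorrScore.Gam_eq_of_spectral hQ hl⟩,
    ⟨(CorrScore.hasFDerivAt_corrOf hC).differentiableAt,
      (CorrScore.posDef_Ed_Gam_Ed hΓ).det_pos.ne'.isUnit, CorrScore.MM_eq hC⟩,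
    CorrScore.score_tDensity hC hν, fun hZ => ?_, CorrScore.score_gaussDensity hC, fun hZ => ?_,
    CorrScore.tendsto_WW C, CorrScore.tendsto_phi⟩
  -- Since `P` is a probability measure, the law of `Z` is one too; this supplies the normalization
  -- of the density.
  · have := hZ.isProbabilityMeasure_iff.1 ‹_›
    have hφ : CorrScore.phi n ν = (1 + 2 / (ν + n))⁻¹ := by
      have h1 : ν + n ≠ 0 := by positivity
      have h2 : ν + n + 2 ≠ 0 := by positivity
      rw [CorrScore.phi]
      field_simp
    rw [hφ]
    exact (CorrScore.isGenerator_t hC hν).infoMatrix_eq hC.1 (fun _ => rfl)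
      (fun z => (CorrScore.score_tDensity hC hν z).2) hZ
  · have := hZ.isProbabilityMeasure_iff.1 ‹_›
    have h := (CorrScore.isGenerator_gauss hC).infoMatrix_eq hC.1 (fun _ => rfl)
      (fun z => (CorrScore.score_gaussDensity hC z).2) hZ
    simpa using h
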